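/- Let $p$ be a prime, $d\ge 2$, and let $F$ be a free metabelian pro-$p$ group on generators $g_1,\dots,g_d$, that is, a metabelian pro-$p$ group such that every map from $\{g_1,\dots,g_d\}$ to a metabelian pro-$p$ group $H$ extends uniquely to a continuous homomorphism $F\to H$. Let $A=F'$ be the (closed) derived subgroup of $F$, $X=F/A$, and $x_i=g_iA\in X$. Then $A$ is abelian; written additively, with $X$ acting by conjugation, $a\cdot(gA)=g^{-1}ag$, it is a module over the completed group algebra $\mathbb{Z}_p[[X]]=\varprojlim_N \mathbb{Z}_p[X/N]$ ($N$ running over the open subgroups of $X$), the action being the one induced on $A=\varprojlim_V A/(A\cap V)$, $V$ running over the open normal subgroups of $F$. For $1\le j\le d$ let $X_j=\overline{\langle x_1,\dots,x_j\rangle}\le X$ and $R_j=\mathbb{Z}_p[[X_j]]$, which acts on $A$ through the map $R_j\to\mathbb{Z}_p[[X]]$ induced by the inclusion $X_j\le X$. Put $u_{ij}=[g_i,g_j]=g_i^{-1}g_j^{-1}g_ig_j$. Then for each $a\in A$ there is exactly one family $(r_{ij})_{1\le i<j\le d}$ with $r_{ij}\in R_j$ for all $i<j$ and $$a=\sum_{1\le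 i<j\le d}u_{ij}r_{ij}.$$ -/

import Mathlib

universe u

open scoped commutatorElement

noncomputable section

/-! ### Completed group algebras -/

/-- The canonical map `k[G ⧸ N] → k[G ⧸ M]` of group algebras, for normal subgroups `N ≤ M`. -/
def quotientAlgebraMap (k : Type*) {G : Type*} [CommRing k] [Group G] (N M : Subgroup G)
    [N.Normal] [M.Normal] (h : N ≤ M) : MonoidAlgebra k (G ⧸ N) →ₐ[k] MonoidAlgebra k (G ⧸ M) :=
  MonoidAlgebra.mapDomainAlgHom k k (QuotientGroup.map N M (MonoidHom.id G) h)

theorem quotientAlgebraMap_single {k G : Type*} [CommRing k] [Group G] (N M : Subgroup G)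
    [N.Normal] [M.Normal] (h : N ≤ M) (x : G) (c : k) :
    quotientAlgebraMap k N M h (MonoidAlgebra.single (x : G ⧸ N) c) =
      MonoidAlgebra.single (x : G ⧸ M) c := by
  simp only [quotientAlgebraMap, MonoidAlgebra.mapDomainAlgHom_apply, MonoidAlgebra.mapDomain_single]
  rfl

/-- The completed group algebra `k[[G]] = lim k[G ⧸ N]`, the inverse limit over all open normal
subgroups `N` of `G`, realised as the algebra of compatible families. -/
def CompletedGroupAlgebra (k G : Type*) [CommRing k] [Group G] [TopologicalSpace G] :
    Subalgebra k (∀ N : OpenNormalSubgroup G, MonoidAlgebra k (G ⧸ N.toSubgroup)) where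
  carrier := {r | ∀ (N M : OpenNormalSubgroup G) (h : N.toSubgroup ≤ M.toSubgroup),
    quotientAlgebraMap k N.toSubgroup M.toSubgroup h (r N) = r M}
  mul_mem' {r s} hr hs N M h := by simp [hr N M h, hs N M h]
  add_mem' {r s} hr hs N M h := by simp [hr N M h, hs N M h]
  algebraMap_mem' c N M h := by
    rw [Pi.algebraMap_apply, Pi.algebraMap_apply]
    exact AlgHom.commutes _ c

/-- The preimage of an open normal subgroup under a continuous homomorphism. -/
def OpenNormalSubgroup.preimage {G H : Type*} [Group G] [TopologicalSpace G] [Group H]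
    [TopologicalSpace H] (f : G →ₜ* H) (N : OpenNormalSubgroup H) : OpenNormalSubgroup G where
  toSubgroup := N.toSubgroup.comap (f : G →* H)
  isOpen' := N.isOpen'.preimage f.continuous_toFun
  isNormal' := inferInstance

/-- The algebra homomorphism `k[[G]] → k[[H]]` induced by a continuous homomorphism `G → H`. -/
def CompletedGroupAlgebra.map (k : Type*) {G H : Type*} [CommRing k] [Group G]
    [TopologicalSpace G] [Group H] [TopologicalSpace H] (f : G →ₜ* H) :
    CompletedGroupAlgebra k G →ₐ[k] CompletedGroupAlgebra k H :=
  AlgHom.codRestrict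
    (AlgHom.pi fun N : OpenNormalSubgroup H =>
      ((MonoidAlgebra.mapDomainAlgHom k k
        (QuotientGroup.map (N.preimage f).toSubgroup N.toSubgroup (f : G →* H) le_rfl)).comp
          (Pi.evalAlgHom k _ (N.preimage f))).comp (CompletedGroupAlgebra k G).val)
    (CompletedGroupAlgebra k H) (by
      intro r N M h
      have hr := r.2 (N.preimage f) (M.preimage f) (Subgroup.comap_mono h)
      simp only [AlgHom.pi_apply, AlgHom.comp_apply, Pi.evalAlgHom_apply, Subalgebra.coe_val]
      rw [← hr]
      simp only [quotientAlgebraMap, ← AlgHom.comp_apply, ← MonoidAlgebra.mapDomainAlgHom_comp]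
      congr 2
      ext x
      rfl)

/-! ### Metabelian pro-`p` groups -/

/-- A profinite group is pro-`p` if all its quotients by open normal subgroups are `p`-groups. -/
class IsProP (p : ℕ) (G : Type*) [Group G] [TopologicalSpace G] [IsTopologicalGroup G]
    [CompactSpace G] [TotallyDisconnectedSpace G] : Prop where
  isPGroup : ∀ N : OpenNormalSubgroup G, IsPGroup p (G ⧸ N.toSubgroup)

/-- A group is metabelian if its second derived subgroup is trivial. -/
class IsMetabelian (G : Type*) [Group G] : Prop where
  derivedSeries_two : derivedSeries G 2 = ⊥

/-- `F`, with the elements `g i`, is a free metabelian pro-`p` group on the `g i`: every map from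
the generators to a metabelian pro-`p` group `H` extends uniquely to a continuous homomorphism
`F → H`. -/
def IsFreeMetabelianProP (p : ℕ) {ι : Type*} {F : Type u} [Group F] [TopologicalSpace F]
    (g : ι → F) : Prop :=
  ∀ (H : Type u) [Group H] [TopologicalSpace H] [IsTopologicalGroup H] [CompactSpace H]
    [TotallyDisconnectedSpace H] [IsProP p H] [IsMetabelian H] (h : ι → H),
    ∃! φ : F →ₜ* H, ∀ i, φ (g i) = h i

/-! ### Existence of free metabelian pro-`p` groups -/

namespace FreeMetabelianProP

variable (p : ℕ) (ι : Type u)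

/-- The normal subgroups `N` of the abstract free group on `ι` such that the quotient by `N` is a
finite metabelian `p`-group. -/
structure Level where
  N : Subgroup (FreeGroup ι)
  nor : N.Normal
  fin : Finite (FreeGroup ι ⧸ N)
  pg : IsPGroup p (FreeGroup ι ⧸ N)
  met : IsMetabelian (FreeGroup ι ⧸ N)

attribute [instance] Level.nor Level.fin Level.met

instance (L : Level p ι) : TopologicalSpace (FreeGroup ι ⧸ L.N) := ⊥
instance (L : Level p ι) : DiscreteTopology (FreeGroup ι ⧸ L.N) := ⟨rfl⟩

/-- The product of all these finite quotients, with the product topology. -/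
abbrev QuotientProd := ∀ L : Level p ι, FreeGroup ι ⧸ L.N

/-- The diagonal map to the product of the quotients. -/
def eta : FreeGroup ι →* QuotientProd p ι := MonoidHom.pi fun L => QuotientGroup.mk' L.N

/-- The closure of the image of the free group on `ι` in the product of its finite metabelian
`p`-quotients: the pro-`p` completion of the free metabelian group on `ι`. -/
abbrev freeGroup : Subgroup (QuotientProd p ι) := (eta p ι).range.topologicalClosure

instance : CompactSpace (freeGroup p ι) :=
    isCompact_iff_compactSpace.mp (Subgroup.isClosed_topologicalClosure _).isCompact

/-- Evaluation at a coordinate. -/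
def ev (L : Level p ι) : freeGroup p ι →* FreeGroup ι ⧸ L.N :=
  (Pi.evalMonoidHom _ L).comp (freeGroup p ι).subtype

instance : IsMetabelian (freeGroup p ι) := ⟨by
  rw [eq_bot_iff]
  intro x hx
  apply Subtype.ext
  funext L
  have : ev p ι L x ∈ derivedSeries (FreeGroup ι ⧸ L.N) 2 :=
    map_derivedSeries_le_derivedSeries (ev p ι L) 2 ⟨x, hx, rfl⟩
  rw [IsMetabelian.derivedSeries_two] at this
  exact this⟩

instance : IsProP p (freeGroup p ι) := ⟨by
  intro N y
  obtain ⟨x, rfl⟩ := QuotientGroup.mk_surjective y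
  obtain ⟨U, hU, hUN⟩ := isOpen_induced_iff.mp N.isOpen'
  have h1 : (1 : QuotientProd p ι) ∈ U := by
    have : (1 : freeGroup p ι) ∈ Subtype.val ⁻¹' U := by rw [hUN]; exact N.one_mem
    exact this
  obtain ⟨J, u, hu, hJ⟩ := isOpen_pi_iff.mp hU 1 h1
  have hk : ∀ L : Level p ι, ∃ k, x.1 L ^ p ^ k = 1 := fun L => L.pg (x.1 L)
  choose k hk using hk
  refine ⟨J.sup k, ?_⟩
  rw [← QuotientGroup.mk_pow, QuotientGroup.eq_one_iff]
  have : x ^ p ^ (J.sup k) ∈ Subtype.val ⁻¹' U := by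
    apply hJ
    intro L hL
    have : (x.1 L) ^ p ^ (J.sup k) = 1 := by
      obtain ⟨m, hm⟩ := pow_dvd_pow p (Finset.le_sup hL : k L ≤ J.sup k)
      rw [hm, pow_mul, hk, one_pow]
    have h2 : (x ^ p ^ (J.sup k)).1 L = 1 := this
    rw [h2]
    exact (hu L hL).2
  rw [hUN] at this
  exact this⟩

/-- The free generators. -/
def gen (i : ι) : freeGroup p ι := ⟨eta p ι (FreeGroup.of i), Subgroup.le_topologicalClosure _ ⟨_, rfl⟩⟩

/-- The map from the abstract free group, with dense image. -/
def eta' : FreeGroup ι →* freeGroup p ι :=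
  (eta p ι).codRestrict _ fun x => Subgroup.le_topologicalClosure _ ⟨x, rfl⟩

theorem isOpen_eval (L : Level p ι) : IsOpen {x : freeGroup p ι | x.1 L = 1} := by
  have hc : Continuous fun x : freeGroup p ι => x.1 L :=
    (continuous_apply L).comp continuous_subtype_val
  exact (isOpen_discrete {(1 : FreeGroup ι ⧸ L.N)}).preimage hc

theorem dense_eta' : DenseRange (eta' p ι) := by
  intro x
  rw [closure_subtype (X := QuotientProd p ι)]
  have hx : (x : QuotientProd p ι) ∈ closure ((eta p ι).range : Set (QuotientProd p ι)) := x.2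
  refine closure_mono ?_ hx
  rintro _ ⟨z, rfl⟩
  exact ⟨_, ⟨z, rfl⟩, rfl⟩

/-- Free metabelian pro-`p` groups exist: the concrete group above is one. -/
theorem isFree_gen : IsFreeMetabelianProP p (gen p ι) := by
  intro H _ _ _ _ _ _ _ h
  let w : FreeGroup ι →* H := FreeGroup.lift h
  let K : Subgroup (freeGroup p ι × H) := ((eta' p ι).prod w).range.topologicalClosure
  have hK : IsClosed (K : Set (freeGroup p ι × H)) := Subgroup.isClosed_topologicalClosure _
  have : CompactSpace K := isCompact_iff_compactSpace.mp hK.isCompact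
  let f : K →* freeGroup p ι := (MonoidHom.fst _ _).comp K.subtype
  have hf : Continuous f := continuous_fst.comp continuous_subtype_val
  have hsurj : Function.Surjective f := by
    have hcl : IsClosed (Set.range f) := (isCompact_range hf).isClosed
    have : Set.range (eta' p ι) ⊆ Set.range f := by
      rintro _ ⟨z, rfl⟩
      exact ⟨⟨(eta' p ι z, w z), Subgroup.le_topologicalClosure _ ⟨z, rfl⟩⟩, rfl⟩
    have h2 := closure_minimal this hcl
    rw [(dense_eta' p ι).closure_eq] at h2
    exact fun x => h2 trivial
  have hinj : Function.Injective f := by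
    rw [injective_iff_map_eq_one]
    rintro ⟨⟨x, y⟩, hxy⟩ hx
    change x = 1 at hx
    subst hx
    apply Subtype.ext
    refine Prod.ext rfl ?_
    change y = 1
    by_contra hy
    obtain ⟨V, hV⟩ := ProfiniteGrp.exist_openNormalSubgroup_sub_open_nhds_of_one
      (isOpen_compl_singleton (x := y)) (by simpa using Ne.symm hy)
    apply hV _ rfl
    have hfin : Finite (H ⧸ V.toSubgroup) :=
      inferInstanceAs (Finite (H ⧸ V.toOpenSubgroup.toSubgroup))
    let N := V.toSubgroup.comap w
    let j : FreeGroup ι ⧸ N →* H ⧸ V.toSubgroup := QuotientGroup.map _ _ w le_rfl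
    have hj : Function.Injective j := by
      rw [injective_iff_map_eq_one]
      intro x hx
      obtain ⟨x, rfl⟩ := QuotientGroup.mk_surjective x
      exact (QuotientGroup.eq_one_iff _).mpr ((QuotientGroup.eq_one_iff (N := V.toSubgroup) _).mp hx)
    let L : Level p ι := ⟨N, inferInstance, Finite.of_injective j hj,
      (IsProP.isPGroup V).of_injective j hj, ⟨by
        rw [eq_bot_iff]
        intro x hx
        have h1 : j x ∈ derivedSeries (H ⧸ V.toSubgroup) 2 :=
          map_derivedSeries_le_derivedSeries j 2 ⟨x, hx, rfl⟩
        have h2 := derivedSeries_le_map_derivedSeries (f := QuotientGroup.mk' V.toSubgroup) (QuotientGroup.mk'_surjective _) 2 h1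
        rw [IsMetabelian.derivedSeries_two] at h2
        obtain ⟨z, hz, hz'⟩ := h2
        have : z = 1 := hz
        subst this
        exact hj (hz'.symm.trans (by simp))⟩⟩
    let O : Set (freeGroup p ι × H) := {z | z.1.1 L = 1 ∧ y⁻¹ * z.2 ∈ V.toSubgroup}
    have hO : IsOpen O := by
      apply IsOpen.inter
      · exact (isOpen_eval p ι L).preimage continuous_fst
      · exact V.isOpen'.preimage (by fun_prop)
    obtain ⟨z, hz, ⟨t, rfl⟩⟩ := mem_closure_iff.mp hxy O hO ⟨rfl, by simp⟩
    have h1 : (QuotientGroup.mk t : FreeGroup ι ⧸ N) = 1 := hz.1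
    have h2 : w t ∈ V.toSubgroup := (QuotientGroup.eq_one_iff (N := N) _).mp h1
    have h3 := V.toSubgroup.mul_mem h2 (V.toSubgroup.inv_mem hz.2)
    have : w t * (y⁻¹ * w t)⁻¹ = y := by group
    change w t * (y⁻¹ * w t)⁻¹ ∈ _ at h3
    rw [this] at h3
    exact h3
  let e := MulEquiv.ofBijective f ⟨hinj, hsurj⟩
  have he : Continuous e.symm := (hf.homeoOfEquivCompactToT2 (f := e.toEquiv)).symm.continuous
  refine ⟨⟨((MonoidHom.snd _ _).comp K.subtype).comp e.symm.toMonoidHom,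
    continuous_snd.comp (continuous_subtype_val.comp he)⟩, ?_, ?_⟩
  · intro i
    have : e.symm (gen p ι i) = ⟨(eta' p ι (.of i), w (.of i)), Subgroup.le_topologicalClosure _ ⟨_, rfl⟩⟩ := by
      rw [MulEquiv.symm_apply_eq]
      rfl
    change (e.symm (gen p ι i)).1.2 = _
    rw [this]
    simp [w]
  · intro φ hφ
    apply ContinuousMonoidHom.ext
    intro x
    refine congrFun ((dense_eta' p ι).equalizer φ.continuous_toFun
      (continuous_snd.comp (continuous_subtype_val.comp he)) ?_) x
    funext z
    have h1 : (φ : freeGroup p ι →* H).comp (eta' p ι) = w :=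
      FreeGroup.ext_hom _ _ fun i => (hφ i).trans FreeGroup.lift_apply_of.symm
    have h2 : e.symm (eta' p ι z) =
        ⟨(eta' p ι z, w z), Subgroup.le_topologicalClosure _ ⟨z, rfl⟩⟩ := by
      rw [MulEquiv.symm_apply_eq]
      rfl
    change φ (eta' p ι z) = (e.symm (eta' p ι z)).1.2
    rw [h2]
    exact DFunLike.congr_fun h1 z

end FreeMetabelianProP

/-- The derived subgroup of a profinite group, in the topological sense: the closed subgroup
generated by all commutators. -/
abbrev closedDerived (F : Type*) [Group F] [TopologicalSpace F] [IsTopologicalGroup F] :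
    Subgroup F :=
  (commutator F).topologicalClosure

section Module

variable (p : ℕ) [Fact p.Prime] {F : Type*} [Group F] [TopologicalSpace F] [IsTopologicalGroup F]
  [CompactSpace F] [TotallyDisconnectedSpace F] [IsProP p F] [IsMetabelian F]

instance closedDerived.commGroup {F : Type*} [Group F] [TopologicalSpace F]
    [IsTopologicalGroup F] [TotallyDisconnectedSpace F] [IsMetabelian F] :
    CommGroup (closedDerived F) :=
  Subgroup.commGroupTopologicalClosure (commutator F) (by
    intro x y
    have h : ⁅(x : F), (y : F)⁆ ∈ derivedSeries F 2 := by
      rw [derivedSeries_succ, derivedSeries_one]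
      exact Subgroup.commutator_mem_commutator x.2 y.2
    rw [IsMetabelian.derivedSeries_two, Subgroup.mem_bot, commutatorElement_eq_one_iff_mul_comm]
      at h
    exact Subtype.ext h)

/-- The action of `X = F/F'` on `A = F'` by `a ↦ a ^ x = g⁻¹ * a * g`, where `x = g F'`
(an action on the left as well as on the right, since `X` is abelian). -/
def conjAction {F : Type*} [Group F] [TopologicalSpace F] [IsTopologicalGroup F]
    [TotallyDisconnectedSpace F] [IsMetabelian F] :
    TopologicalAbelianization F →* MulAut (closedDerived F) :=
  (QuotientGroup.lift (closedDerived F) MulAut.conjNormal (by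
    intro a ha
    ext b
    have h : (⟨a, ha⟩ : closedDerived F) * b = b * ⟨a, ha⟩ := mul_comm _ _
    have h' : a * (b : F) = b * a := congrArg Subtype.val h
    simp [MulAut.conjNormal_apply, h'])).comp invMonoidHom

/-- The image in `X = F/F'` of an open normal subgroup of `F`. -/
def OpenNormalSubgroup.imageAb {F : Type*} [Group F] [TopologicalSpace F] [IsTopologicalGroup F]
    (V : OpenNormalSubgroup F) : OpenNormalSubgroup (TopologicalAbelianization F) where
  toSubgroup := V.toSubgroup.map (QuotientGroup.mk' (closedDerived F))
  isOpen' := QuotientGroup.isOpenMap_coe _ V.isOpen'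
  isNormal' := V.isNormal'.map _ (QuotientGroup.mk'_surjective _)

/-- The finite quotient `A/(A ∩ V)` of `A = F'`, for `V` an open normal subgroup of `F`. -/
abbrev DerivedLevel {F : Type*} [Group F] [TopologicalSpace F] [IsTopologicalGroup F]
    (V : OpenNormalSubgroup F) : Type _ :=
  closedDerived F ⧸ V.toSubgroup.subgroupOf (closedDerived F)

instance DerivedLevel.commGroup {F : Type*} [Group F] [TopologicalSpace F]
    [IsTopologicalGroup F] [TotallyDisconnectedSpace F] [IsMetabelian F]
    (V : OpenNormalSubgroup F) : CommGroup (DerivedLevel V) :=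
  QuotientGroup.Quotient.commGroup _

theorem DerivedLevel.pow_smul_eq_zero (V : OpenNormalSubgroup F) (q : Additive (DerivedLevel V)) :
    (p ^ Nat.card (F ⧸ V.toSubgroup)) • q = 0 := by
  obtain ⟨a, ha⟩ := QuotientGroup.mk_surjective (s := V.toSubgroup.subgroupOf (closedDerived F))
    (Additive.toMul q)
  have hfin : Finite (F ⧸ V.toSubgroup) :=
    inferInstanceAs (Finite (F ⧸ V.toOpenSubgroup.toSubgroup))
  obtain ⟨k, hk⟩ := (IsPGroup.iff_card (p := p)).mp (IsProP.isPGroup (p := p) V)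
  have hdvd : Nat.card (F ⧸ V.toSubgroup) ∣ p ^ Nat.card (F ⧸ V.toSubgroup) := by
    conv_lhs => rw [hk]
    refine pow_dvd_pow p ?_
    rw [hk]
    exact (Nat.lt_pow_self (Fact.out : p.Prime).one_lt).le
  have h1 : (QuotientGroup.mk (a : F) : F ⧸ V.toSubgroup) ^ (p ^ Nat.card (F ⧸ V.toSubgroup)) = 1 :=
    orderOf_dvd_iff_pow_eq_one.mp ((orderOf_dvd_natCard _).trans hdvd)
  apply Additive.toMul.injective
  rw [toMul_nsmul, ← ha, toMul_zero, ← QuotientGroup.mk_pow, QuotientGroup.eq_one_iff]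
  rw [← QuotientGroup.mk_pow, QuotientGroup.eq_one_iff] at h1
  exact h1

/-- The finite abelian `p`-group `A/(A ∩ V)` is a `ℤ_p`-module: `ℤ_p` acts through its residues
modulo a power of `p` that kills `A/(A ∩ V)`. -/
instance DerivedLevel.module (V : OpenNormalSubgroup F) :
    Module ℤ_[p] (Additive (DerivedLevel V)) :=
  letI : Module (ZMod (p ^ Nat.card (F ⧸ V.toSubgroup))) (Additive (DerivedLevel V)) :=
    AddCommGroup.zmodModule (DerivedLevel.pow_smul_eq_zero p V)
  Module.compHom _ (PadicInt.toZModPow (p := p) (Nat.card (F ⧸ V.toSubgroup)))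

theorem DerivedLevel.map_padic_smul (V : OpenNormalSubgroup F) {M : Type*} [AddCommGroup M]
    [Module ℤ_[p] M] (f : Additive (DerivedLevel V) →+ M) (c : ℤ_[p])
    (q : Additive (DerivedLevel V)) : f (c • q) = c • f q := by
  obtain ⟨w, hw⟩ := Ideal.mem_span_singleton'.mp
    (PadicInt.appr_spec (p := p) (Nat.card (F ⧸ V.toSubgroup)) c)
  have hc : c = (c.appr (Nat.card (F ⧸ V.toSubgroup)) : ℤ_[p]) +
      w * ((p ^ Nat.card (F ⧸ V.toSubgroup) : ℕ) : ℤ_[p]) := by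
    push_cast
    rw [hw]
    ring
  rw [hc, add_smul, add_smul, mul_smul, mul_smul, Nat.cast_smul_eq_nsmul, Nat.cast_smul_eq_nsmul,
    Nat.cast_smul_eq_nsmul, Nat.cast_smul_eq_nsmul, ← map_nsmul, ← map_nsmul, map_add,
    pow_smul_eq_zero, smul_zero, map_zero, smul_zero]

/-- The projection of `A = F'`, written additively, onto `A/(A ∩ V)`. -/
def DerivedLevel.proj (V : OpenNormalSubgroup F) :
    Additive (closedDerived F) →+ Additive (DerivedLevel V) :=
  MonoidHom.toAdditive (QuotientGroup.mk' (V.toSubgroup.subgroupOf (closedDerived F)))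

theorem DerivedLevel.proj_surjective {F : Type*} [Group F] [TopologicalSpace F]
    [IsTopologicalGroup F] (V : OpenNormalSubgroup F) :
    Function.Surjective (DerivedLevel.proj V) :=
  QuotientGroup.mk'_surjective (V.toSubgroup.subgroupOf (closedDerived F))

/-- The action of `X/(image of V)` on `A/(A ∩ V)` induced by the action of `X` on `A`. -/
def DerivedLevel.action (V : OpenNormalSubgroup F) :
    TopologicalAbelianization F ⧸ V.imageAb.toSubgroup →*
      AddMonoid.End (Additive (DerivedLevel V)) :=
  QuotientGroup.lift _
    { toFun := fun x => MonoidHom.toAdditive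
        (QuotientGroup.map _ _ (conjAction x).toMonoidHom (by
          obtain ⟨g, rfl⟩ := QuotientGroup.mk_surjective x
          intro a ha
          have := V.isNormal'.conj_mem _ ha g⁻¹
          exact this))
      map_one' := by
        ext q
        obtain ⟨a, rfl⟩ := DerivedLevel.proj_surjective V q
        exact congrArg (fun b => DerivedLevel.proj V (Additive.ofMul b))
          (DFunLike.congr_fun (map_one conjAction) a.toMul)
      map_mul' := fun x y => by
        ext q
        obtain ⟨a, rfl⟩ := DerivedLevel.proj_surjective V q
        exact congrArg (fun b => DerivedLevel.proj V (Additive.ofMul b))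
          (DFunLike.congr_fun (map_mul conjAction x y) a.toMul) }
    (by
      rintro _ ⟨g, hg, rfl⟩
      ext q
      obtain ⟨a, rfl⟩ := DerivedLevel.proj_surjective V q
      refine (QuotientGroup.eq (s := V.toSubgroup.subgroupOf (closedDerived F))).mpr ?_
      have h1 := V.toSubgroup.mul_mem (V.toSubgroup.inv_mem hg)
        (V.isNormal'.conj_mem g hg (a.toMul : F)⁻¹)
      have h2 : ((g⁻¹ * (a.toMul : F) * g⁻¹⁻¹)⁻¹ * (a.toMul : F)) ∈ V.toSubgroup := by
        convert h1 using 1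
        group
      exact h2)

/-- The `ℤ_p`-linear representation of `X/(image of V)` on `A/(A ∩ V)`. -/
def DerivedLevel.rep (V : OpenNormalSubgroup F) :
    Representation ℤ_[p] (TopologicalAbelianization F ⧸ V.imageAb.toSubgroup)
      (Additive (DerivedLevel V)) where
  toFun x :=
    { DerivedLevel.action V x with
      map_smul' := fun c q => DerivedLevel.map_padic_smul p V (DerivedLevel.action V x) c q }
  map_one' := by
    ext q
    exact DFunLike.congr_fun (map_one (DerivedLevel.action V)) q
  map_mul' x y := by
    ext q
    exact DFunLike.congr_fun (map_mul (DerivedLevel.action V) x y) q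

/-- `ℤ_p[[X]]` acts on `A/(A ∩ V)` through the group algebra `ℤ_p[X/(image of V)]`. -/
def DerivedLevel.ringHom (V : OpenNormalSubgroup F) :
    CompletedGroupAlgebra ℤ_[p] (TopologicalAbelianization F) →ₐ[ℤ_[p]]
      Module.End ℤ_[p] (Additive (DerivedLevel V)) :=
  ((DerivedLevel.rep p V).asAlgebraHom.comp (Pi.evalAlgHom ℤ_[p] _ V.imageAb)).comp
    (CompletedGroupAlgebra ℤ_[p] (TopologicalAbelianization F)).val

/-- The projection `A/(A ∩ V) → A/(A ∩ W)` for `V ≤ W`. -/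
def DerivedLevel.trans {V W : OpenNormalSubgroup F} (h : V.toSubgroup ≤ W.toSubgroup) :
    Additive (DerivedLevel V) →+ Additive (DerivedLevel W) :=
  MonoidHom.toAdditive (QuotientGroup.map _ _ (MonoidHom.id _) (fun _ ha => h ha))

theorem DerivedLevel.trans_ringHom {V W : OpenNormalSubgroup F}
    (h : V.toSubgroup ≤ W.toSubgroup)
    (r : CompletedGroupAlgebra ℤ_[p] (TopologicalAbelianization F))
    (q : Additive (DerivedLevel V)) :
    DerivedLevel.trans h (DerivedLevel.ringHom p V r q) =
      DerivedLevel.ringHom p W r (DerivedLevel.trans h q) := by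
  have hle : V.imageAb.toSubgroup ≤ W.imageAb.toSubgroup := Subgroup.map_mono h
  have hr := r.2 V.imageAb W.imageAb hle
  simp only [DerivedLevel.ringHom, AlgHom.comp_apply, Pi.evalAlgHom_apply, Subalgebra.coe_val]
  rw [← hr]
  generalize r.1 V.imageAb = s
  induction s using MonoidAlgebra.induction_linear with
  | zero => simp
  | add s t hs ht => simp only [map_add, LinearMap.add_apply, hs, ht]
  | single x c =>
    obtain ⟨x, rfl⟩ := QuotientGroup.mk_surjective x
    obtain ⟨a, rfl⟩ := DerivedLevel.proj_surjective V q
    rw [quotientAlgebraMap_single,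
      Representation.asAlgebraHom_single, Representation.asAlgebraHom_single,
      LinearMap.smul_apply, LinearMap.smul_apply, DerivedLevel.map_padic_smul]
    rfl

theorem closedDerived.ext_proj {F : Type*} [Group F] [TopologicalSpace F] [IsTopologicalGroup F]
    [CompactSpace F] [TotallyDisconnectedSpace F] {a b : Additive (closedDerived F)}
    (h : ∀ V : OpenNormalSubgroup F, DerivedLevel.proj V a = DerivedLevel.proj V b) : a = b := by
  apply Additive.toMul.injective
  apply Subtype.ext
  by_contra hne
  have hne' : ((a.toMul : F))⁻¹ * (b.toMul : F) ≠ 1 := fun h1 => hne (inv_mul_eq_one.mp h1)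
  obtain ⟨V, hV⟩ := ProfiniteGrp.exist_openNormalSubgroup_sub_open_nhds_of_one
    (isOpen_compl_singleton (x := ((a.toMul : F))⁻¹ * (b.toMul : F))) (by
      simpa using hne'.symm)
  have h1 : ((a.toMul : F))⁻¹ * (b.toMul : F) ∈ V.toSubgroup :=
    (QuotientGroup.eq (s := V.toSubgroup.subgroupOf (closedDerived F))).mp (h V)
  exact hV h1 rfl

theorem closedDerived.exists_smul
    (r : CompletedGroupAlgebra ℤ_[p] (TopologicalAbelianization F))
    (a : Additive (closedDerived F)) :
    ∃ b : Additive (closedDerived F), ∀ V : OpenNormalSubgroup F,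
      DerivedLevel.proj V b = DerivedLevel.ringHom p V r (DerivedLevel.proj V a) := by
  have hcpt : CompactSpace (closedDerived F) :=
    isCompact_iff_compactSpace.mp (Subgroup.isClosed_topologicalClosure _).isCompact
  let C : OpenNormalSubgroup F → Set (closedDerived F) := fun V =>
    {b | DerivedLevel.proj V (Additive.ofMul b) =
      DerivedLevel.ringHom p V r (DerivedLevel.proj V a)}
  have hne : ∀ V, (C V).Nonempty := fun V => by
    obtain ⟨b, hb⟩ := DerivedLevel.proj_surjective V
      (DerivedLevel.ringHom p V r (DerivedLevel.proj V a))
    exact ⟨b.toMul, hb⟩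
  have hcl : ∀ V, IsClosed (C V) := fun V => by
    obtain ⟨b, hb⟩ := hne V
    have : C V = (fun c : closedDerived F => (b : F)⁻¹ * (c : F)) ⁻¹' (V : Set F) := by
      ext c
      change _ = _ ↔ _
      rw [← hb, eq_comm]
      exact QuotientGroup.eq
    rw [this]
    exact V.toOpenSubgroup.isClosed.preimage (by fun_prop)
  have hmono : ∀ V W : OpenNormalSubgroup F, V.toSubgroup ≤ W.toSubgroup → C V ⊆ C W := by
    intro V W h b hb
    have := congrArg (DerivedLevel.trans h) hb
    rw [DerivedLevel.trans_ringHom] at this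
    exact this
  have hdir : Directed (· ⊇ ·) C := fun V W =>
    ⟨V ⊓ W, hmono _ _ (fun _ hx => hx.1), hmono _ _ (fun _ hx => hx.2)⟩
  have : Nonempty (OpenNormalSubgroup F) :=
    ⟨(ProfiniteGrp.exist_openNormalSubgroup_sub_open_nhds_of_one isOpen_univ
      (Set.mem_univ (1 : F))).choose⟩
  obtain ⟨b, hb⟩ := IsCompact.nonempty_iInter_of_directed_nonempty_isCompact_isClosed C hdir hne
    (fun V => (hcl V).isCompact) hcl
  exact ⟨Additive.ofMul b, fun V => Set.mem_iInter.mp hb V⟩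

/-- The action of `ℤ_p[[X]]` on `A = lim A/(A ∩ V)` (written additively) : `r • a` is the unique
element of `A` whose image in each `A/(A ∩ V)` is the image of `a` acted upon by `r`. -/
instance closedDerived.smul :
    SMul (CompletedGroupAlgebra ℤ_[p] (TopologicalAbelianization F))
      (Additive (closedDerived F)) where
  smul r a := (closedDerived.exists_smul p r a).choose

theorem closedDerived.proj_smul (V : OpenNormalSubgroup F)
    (r : CompletedGroupAlgebra ℤ_[p] (TopologicalAbelianization F))
    (a : Additive (closedDerived F)) :
    DerivedLevel.proj V (r • a) = DerivedLevel.ringHom p V r (DerivedLevel.proj V a) :=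
  (closedDerived.exists_smul p r a).choose_spec V

/-- `A = F'` is a module over the completed group algebra `ℤ_p[[X]]`. -/
instance closedDerived.module :
    Module (CompletedGroupAlgebra ℤ_[p] (TopologicalAbelianization F))
      (Additive (closedDerived F)) where
  one_smul a := closedDerived.ext_proj fun V => by simp [closedDerived.proj_smul]
  mul_smul r s a := closedDerived.ext_proj fun V => by simp [closedDerived.proj_smul]
  smul_zero r := closedDerived.ext_proj fun V => by simp [closedDerived.proj_smul]
  smul_add r a b := closedDerived.ext_proj fun V => by simp [closedDerived.proj_smul]
  add_smul r s a := closedDerived.ext_proj fun V => by simp [closedDerived.proj_smul]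
  zero_smul a := closedDerived.ext_proj fun V => by simp [closedDerived.proj_smul]

end Module

/-! ### The data of the normal form -/

section NormalForm

variable {d : ℕ} {F : Type*} [Group F] [TopologicalSpace F] [IsTopologicalGroup F]

/-- The closed subgroup `X_j` of `X = F/F'` topologically generated by the images of `g_i`, for
`i ≤ j`. -/
def closedSpan (g : Fin d → F) (j : Fin d) : Subgroup (TopologicalAbelianization F) :=
  (Subgroup.closure ((fun i => (g i : TopologicalAbelianization F)) '' Set.Iic j)).topologicalClosure

/-- The continuous inclusion of a subgroup. -/
def inclusionHom {G : Type*} [Group G] [TopologicalSpace G] (H : Subgroup G) : H →ₜ* G where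
  toMonoidHom := H.subtype
  continuous_toFun := continuous_subtype_val

/-- The element `u_ij = [g_i, g_j] = g_i⁻¹ g_j⁻¹ g_i g_j` of `A = F'`, written additively. -/
def basicCommutator (g : Fin d → F) (i j : Fin d) : Additive (closedDerived F) :=
  Additive.ofMul ⟨(g i)⁻¹ * (g j)⁻¹ * g i * g j, Subgroup.le_topologicalClosure _ (by
    have h := Subgroup.commutator_mem_commutator (Subgroup.mem_top (g i)⁻¹)
      (Subgroup.mem_top (g j)⁻¹)
    rw [commutatorElement_def, inv_inv, inv_inv] at h
    exact h)⟩

end NormalForm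

end

/-! Existence. By the universal property the `g i` generate `F` topologically. Let `P` be the set of
all sums `∑ u_ij r_ij`. It is the continuous image of a compact product of the rings `R_j`, hence a
closed subgroup (`isClosed_range_normalFormMap`). It is stable under conjugation by each `g k` and
its inverse (`of_smul_mem_range`): if `k ≤ j`, the factor `x_k` is absorbed by `R_j`; if `k > j`,
the Jacobi identity `u_ij (x_k - 1) = u_ik (x_j - 1) - u_jk (x_i - 1)` moves the excess to `u_ik`
and `u_jk`, whose coefficients may lie in the larger ring `R_k`. So `P` is closed, normal and
contains all `[g i, g j]`; then `F/P` is abelian and `F' ≤ P`.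

Uniqueness. Freeness allows `g i` to be sent to arbitrary matrices `(y_i, 0; b_i, 1)` over a finite
quotient `B` of the group algebra. On `F'` the entry `b` is semilinear and takes `u_ij` to `(y_j -
1) b_i - (y_i - 1) b_j`. Suppose `∑ u_ij r_ij = 0` and `r_ij = 0` for `j > m`. With `b` the `k`-th
unit vector, subtract the relation in which `y_m` is replaced by `1`. A coefficient with `j < m`
involves only `x_1, …, x_j`, so its term does not change, and only `(y_m - 1) r_km = 0` is left
(`exists_sub_one_mul_eq_zero`).

In a finite group algebra `y_m - 1` is a zero divisor. But an element of `(ℤ/p^l)[(ℤ/p^(n+l))^d]`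
killed by it is constant on cosets of a subgroup of order `p^l` that dies in `(ℤ/p^n)^d`, so its
image there is a multiple of `p^l`, that is, zero. Letting `l` and `n` vary gives `r_km = 0`, since
the kernels of `X_m → (ℤ/p^n)^d` are cofinal. Descending induction on `m` finishes the proof. -/

noncomputable section

/-! ### Completed group algebras: functoriality and evaluation -/

namespace CompletedGroupAlgebra

variable {k G H K : Type*} [CommRing k] [Group G] [TopologicalSpace G] [Group H]
  [TopologicalSpace H] [Group K] [TopologicalSpace K]

theorem ext_val {r s : CompletedGroupAlgebra k G} (h : ∀ N, r.1 N = s.1 N) : r = s :=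
  Subtype.ext (funext h)

/-- The canonical map from `G` to the completed group algebra `k[[G]]`. -/
def of (k : Type*) {G : Type*} [CommRing k] [Group G] [TopologicalSpace G] :
    G →* CompletedGroupAlgebra k G where
  toFun x := ⟨fun N => MonoidAlgebra.single (x : G ⧸ N.toSubgroup) 1,
    fun N M h => quotientAlgebraMap_single N.toSubgroup M.toSubgroup h x 1⟩
  map_one' := rfl
  map_mul' x y := ext_val fun N => by simp [MonoidAlgebra.single_mul_single]

theorem of_val (x : G) (N : OpenNormalSubgroup G) :
    (of k x).1 N = MonoidAlgebra.single (x : G ⧸ N.toSubgroup) 1 := rfl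

theorem map_val (f : G →ₜ* H) (r : CompletedGroupAlgebra k G) (N : OpenNormalSubgroup H) :
    (map k f r).1 N = MonoidAlgebra.mapDomainAlgHom k k
      (QuotientGroup.map (N.preimage f).toSubgroup N.toSubgroup (f : G →* H) le_rfl)
        (r.1 (N.preimage f)) := rfl

theorem map_of (f : G →ₜ* H) (x : G) : map k f (of k x) = of k (f x) :=
  ext_val fun N => by
    rw [map_val, of_val, of_val, MonoidAlgebra.mapDomainAlgHom_apply,
      MonoidAlgebra.mapDomain_single]
    rfl

theorem map_map (f : G →ₜ* H) (f' : H →ₜ* K) (r : CompletedGroupAlgebra k G) :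
    map k f' (map k f r) = map k (f'.comp f) r :=
  ext_val fun N => by
    rw [map_val, map_val, map_val, ← AlgHom.comp_apply, ← MonoidAlgebra.mapDomainAlgHom_comp]
    congr 2
    ext x
    rfl

theorem of_mul_comm (hG : ∀ x y : G, x * y = y * x) (x : G) (r : CompletedGroupAlgebra k G) :
    of k x * r = r * of k x :=
  ext_val fun N => by
    change (of k x).1 N * r.1 N = r.1 N * (of k x).1 N
    rw [of_val]
    generalize r.1 N = s
    induction s using MonoidAlgebra.induction_linear with
    | zero => simp
    | add s t hs ht => rw [mul_add, add_mul, hs, ht]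
    | single y c =>
      obtain ⟨y, rfl⟩ := QuotientGroup.mk_surjective y
      rw [MonoidAlgebra.single_mul_single, MonoidAlgebra.single_mul_single,
        ← QuotientGroup.mk_mul, ← QuotientGroup.mk_mul, hG, one_mul, mul_one]

variable {B C : Type*} [CommRing B] [Algebra k B] [CommRing C] [Algebra k C]

/-- The kernel of a homomorphism, as an open normal subgroup when it is open. -/
abbrev openKer (ψ : G →* B) (hψ : IsOpen (ψ.ker : Set G)) : OpenNormalSubgroup G where
  toSubgroup := ψ.ker
  isOpen' := hψ
  isNormal' := inferInstance

/-- The algebra homomorphism `k[[G]] → B` induced by a homomorphism `G → B` with open kernel. -/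
def lift (ψ : G →* B) (hψ : IsOpen (ψ.ker : Set G)) : CompletedGroupAlgebra k G →ₐ[k] B :=
  ((MonoidAlgebra.lift k B (G ⧸ ψ.ker) (QuotientGroup.lift ψ.ker ψ le_rfl)).comp
    (Pi.evalAlgHom k (fun N : OpenNormalSubgroup G => MonoidAlgebra k (G ⧸ N.toSubgroup))
      (openKer ψ hψ))).comp (CompletedGroupAlgebra k G).val

/-- By compatibility of the family, any level below the kernel computes the lift. This makes lifts
with different kernels comparable. -/
theorem lift_eq_of_le (ψ : G →* B) (hψ : IsOpen (ψ.ker : Set G)) (N : OpenNormalSubgroup G)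
    (hN : N.toSubgroup ≤ ψ.ker) (r : CompletedGroupAlgebra k G) :
    lift ψ hψ r = MonoidAlgebra.lift k B (G ⧸ N.toSubgroup) (QuotientGroup.lift _ ψ hN)
      (r.1 N) := by
  change MonoidAlgebra.lift k B (G ⧸ ψ.ker) (QuotientGroup.lift ψ.ker ψ le_rfl)
    (r.1 (openKer ψ hψ)) = _
  rw [← r.2 N (openKer ψ hψ) hN]
  generalize r.1 N = s
  induction s using MonoidAlgebra.induction_linear with
  | zero => simp
  | add s t hs ht => rw [map_add, map_add, hs, ht, map_add]
  | single y c =>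
    obtain ⟨y, rfl⟩ := QuotientGroup.mk_surjective y
    rw [quotientAlgebraMap_single, MonoidAlgebra.lift_single, MonoidAlgebra.lift_single]
    rfl

theorem lift_val (ψ : G →* B) (hψ : IsOpen (ψ.ker : Set G)) (r : CompletedGroupAlgebra k G) :
    lift ψ hψ r = MonoidAlgebra.lift k B (G ⧸ ψ.ker) (QuotientGroup.lift ψ.ker ψ le_rfl)
      (r.1 (openKer ψ hψ)) := rfl

theorem isOpen_ker_comp (f : G →ₜ* H) (ψ : H →* B) (hψ : IsOpen (ψ.ker : Set H)) :
    IsOpen ((ψ.comp (f : G →* H)).ker : Set G) :=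
  hψ.preimage f.continuous_toFun

theorem lift_map (f : G →ₜ* H) (ψ : H →* B) (hψ : IsOpen (ψ.ker : Set H))
    (r : CompletedGroupAlgebra k G) :
    lift ψ hψ (map k f r) = lift (ψ.comp (f : G →* H)) (isOpen_ker_comp f ψ hψ) r := by
  rw [lift_val, map_val, lift_eq_of_le (ψ.comp (f : G →* H)) _ ((openKer ψ hψ).preimage f)
    (fun _ h => h)]
  generalize r.1 _ = s
  induction s using MonoidAlgebra.induction_linear with
  | zero => simp
  | add s t hs ht => rw [map_add, map_add, hs, ht, map_add]
  | single y c =>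
    obtain ⟨y, rfl⟩ := QuotientGroup.mk_surjective y
    rw [MonoidAlgebra.mapDomainAlgHom_apply, MonoidAlgebra.mapDomain_single,
      MonoidAlgebra.lift_single, MonoidAlgebra.lift_single]
    rfl

theorem algHom_lift (π : B →ₐ[k] C) (ψ : G →* B) (hψ : IsOpen (ψ.ker : Set G))
    (ψ' : G →* C) (hψ' : IsOpen (ψ'.ker : Set G)) (h : ∀ x, π (ψ x) = ψ' x)
    (r : CompletedGroupAlgebra k G) : π (lift ψ hψ r) = lift ψ' hψ' r := by
  have hle : ψ.ker ≤ ψ'.ker := fun x hx => by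
    rw [MonoidHom.mem_ker] at hx ⊢
    rw [← h, hx, map_one]
  rw [lift_val, lift_eq_of_le ψ' hψ' (openKer ψ hψ) hle]
  generalize r.1 _ = s
  induction s using MonoidAlgebra.induction_linear with
  | zero => simp
  | add s t hs ht => rw [map_add, map_add, hs, ht, map_add]
  | single y c =>
    obtain ⟨y, rfl⟩ := QuotientGroup.mk_surjective y
    rw [MonoidAlgebra.lift_single, MonoidAlgebra.lift_single, map_smul]
    exact congrArg (c • ·) (h y)

end CompletedGroupAlgebra

/-! ### Compactness of `ℤ_p[[G]]` -/

theorem MonoidAlgebra.linearMap_apply_eq_sum {k G M : Type*} [CommRing k] [Fintype G]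
    [AddCommGroup M] [Module k M] (L : MonoidAlgebra k G →ₗ[k] M) (s : MonoidAlgebra k G) :
    L s = ∑ x, s.coeff x • L (MonoidAlgebra.single x 1) := by
  classical
  induction s using MonoidAlgebra.induction_linear with
  | zero => simp
  | add s t hs ht => simp [hs, ht, add_smul, Finset.sum_add_distrib]
  | single y c =>
    rw [Finset.sum_eq_single y]
    · rw [← map_smul]
      simp
    · intro x _ hx
      simp [MonoidAlgebra.coeff_single, hx.symm]
    · simp

theorem OpenNormalSubgroup.finite_quotient {G : Type*} [Group G] [TopologicalSpace G]
    [IsTopologicalGroup G] [CompactSpace G] (N : OpenNormalSubgroup G) :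
    Finite (G ⧸ N.toSubgroup) :=
  inferInstanceAs (Finite (G ⧸ N.toOpenSubgroup.toSubgroup))

namespace CompletedGroupAlgebra

variable {k G : Type*} [CommRing k] [Group G] [TopologicalSpace G]

/-- The coefficients of all components of an element of `k[[G]]`. -/
def coeffs (r : CompletedGroupAlgebra k G) (N : OpenNormalSubgroup G) (x : G ⧸ N.toSubgroup) : k :=
  (r.1 N).coeff x

/-- The topology on `k[[G]]` of pointwise convergence of all coefficients. -/
abbrev coeffTopology [TopologicalSpace k] : TopologicalSpace (CompletedGroupAlgebra k G) :=
  TopologicalSpace.induced coeffs inferInstance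

attribute [local instance] coeffTopology

theorem continuous_coeffs [TopologicalSpace k] :
    Continuous (coeffs : CompletedGroupAlgebra k G → _) :=
  continuous_induced_dom

theorem coeffs_injective : Function.Injective (coeffs : CompletedGroupAlgebra k G → _) := by
  intro r s h
  refine ext_val fun N => ?_
  apply MonoidAlgebra.coeff_injective
  ext x
  exact congrFun (congrFun h N) x

/-- All quotients are finite, so each compatibility condition is a linear equation in finitely many
coefficients and defines a closed set. -/
theorem isClosed_range_coeffs [TopologicalSpace k] [IsTopologicalRing k] [T2Space k]
    [IsTopologicalGroup G] [CompactSpace G] :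
    IsClosed (Set.range (coeffs : CompletedGroupAlgebra k G → _)) := by
  have hfin := OpenNormalSubgroup.finite_quotient (G := G)
  have hft : ∀ N : OpenNormalSubgroup G, Fintype (G ⧸ N.toSubgroup) := fun N => Fintype.ofFinite _
  let L : ∀ (N M : OpenNormalSubgroup G) (h : N.toSubgroup ≤ M.toSubgroup) (y : G ⧸ M.toSubgroup),
      MonoidAlgebra k (G ⧸ N.toSubgroup) →ₗ[k] k := fun N M h y =>
    { toFun := fun s => (quotientAlgebraMap k N.toSubgroup M.toSubgroup h s).coeff y
      map_add' := by simp
      map_smul' := by simp }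
  have : Set.range (coeffs : CompletedGroupAlgebra k G → _) =
      {f | ∀ (N M : OpenNormalSubgroup G) (h : N.toSubgroup ≤ M.toSubgroup) (y : G ⧸ M.toSubgroup),
        ∑ x, f N x • L N M h y (MonoidAlgebra.single x 1) = f M y} := by
    ext f
    constructor
    · rintro ⟨r, rfl⟩ N M h y
      refine (MonoidAlgebra.linearMap_apply_eq_sum (L N M h y) (r.1 N)).symm.trans ?_
      exact congrArg (fun s => s.coeff y) (r.2 N M h)
    · intro hf
      refine ⟨⟨fun N => .ofCoeff (Finsupp.equivFunOnFinite.symm (f N)), fun N M h => ?_⟩, ?_⟩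
      · apply MonoidAlgebra.coeff_injective
        ext y
        refine (MonoidAlgebra.linearMap_apply_eq_sum (L N M h y) _).trans ?_
        exact hf N M h y
      · rfl
  rw [this]
  simp only [Set.ofPred_forall]
  refine isClosed_iInter fun N => isClosed_iInter fun M => isClosed_iInter fun h =>
    isClosed_iInter fun y => isClosed_eq ?_ (by fun_prop)
  refine continuous_finsetSum _ fun x _ => ?_
  have hc : Continuous fun f : ∀ N : OpenNormalSubgroup G, G ⧸ N.toSubgroup → k => f N x :=
    continuous_pi_iff.mp (continuous_pi_iff.mp continuous_id N) x
  exact hc.smul continuous_const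

theorem compactSpace [TopologicalSpace k] [IsTopologicalRing k] [T2Space k] [CompactSpace k]
    [IsTopologicalGroup G] [CompactSpace G] : CompactSpace (CompletedGroupAlgebra k G) :=
  Topology.IsClosedEmbedding.compactSpace (f := coeffs)
    ⟨⟨⟨rfl⟩, coeffs_injective⟩, isClosed_range_coeffs⟩

end CompletedGroupAlgebra

/-! ### Continuity of the action of the completed group algebra on `F'` -/

section Continuity

variable (p : ℕ) [Fact p.Prime] {F : Type*} [Group F] [TopologicalSpace F] [IsTopologicalGroup F]
  [CompactSpace F] [TotallyDisconnectedSpace F] [IsProP p F] [IsMetabelian F]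

theorem IsLocallyConstant.finset_sum {T ι M : Type*} [TopologicalSpace T] [AddCommMonoid M]
    (s : Finset ι) (f : ι → T → M) (h : ∀ i ∈ s, IsLocallyConstant (f i)) :
    IsLocallyConstant fun t => ∑ i ∈ s, f i t := by
  classical
  induction s using Finset.induction_on with
  | empty => exact IsLocallyConstant.const (0 : M)
  | insert i s hi ih =>
    simp only [Finset.sum_insert hi]
    exact (h i (Finset.mem_insert_self i s)).add
      (ih fun j hj => h j (Finset.mem_insert_of_mem hj))

/-- The scalar matters only modulo a power of `p` that kills the finite module, and congruence
classes are open. -/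
theorem DerivedLevel.isLocallyConstant_smul (V : OpenNormalSubgroup F)
    (q : Additive (DerivedLevel V)) : IsLocallyConstant fun c : ℤ_[p] => c • q := by
  rw [IsLocallyConstant.iff_eventually_eq]
  intro c
  have hp : (0 : ℝ) < (p : ℝ) ^ (-(Nat.card (F ⧸ V.toSubgroup) : ℤ)) :=
    zpow_pos (by exact_mod_cast (Fact.out : p.Prime).pos) _
  filter_upwards [Metric.ball_mem_nhds c hp] with c' hc'
  have h1 : ‖c' - c‖ ≤ (p : ℝ) ^ (-(Nat.card (F ⧸ V.toSubgroup) : ℤ)) := by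
    rw [← dist_eq_norm]
    exact (Metric.mem_ball.mp hc').le
  rw [PadicInt.norm_le_pow_iff_mem_span_pow] at h1
  obtain ⟨w, hw⟩ := Ideal.mem_span_singleton'.mp h1
  rw [← sub_eq_zero, ← sub_smul, ← hw, mul_smul, ← Nat.cast_pow, Nat.cast_smul_eq_nsmul,
    DerivedLevel.pow_smul_eq_zero, smul_zero]

attribute [local instance] CompletedGroupAlgebra.coeffTopology

/-- Modulo `V`, the result depends only on the component of `r` at the preimage of `V.imageAb`,
hence on finitely many `p`-adic coefficients. -/
theorem closedDerived.isLocallyConstant_proj_map_smul {G : Type*} [Group G] [TopologicalSpace G]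
    [IsTopologicalGroup G] [CompactSpace G] (f : G →ₜ* TopologicalAbelianization F)
    (u : Additive (closedDerived F)) (V : OpenNormalSubgroup F) :
    IsLocallyConstant fun r : CompletedGroupAlgebra ℤ_[p] G =>
      DerivedLevel.proj V (CompletedGroupAlgebra.map ℤ_[p] f r • u) := by
  let N := V.imageAb.preimage f
  have := N.finite_quotient
  have : Fintype (G ⧸ N.toSubgroup) := Fintype.ofFinite _
  let L : MonoidAlgebra ℤ_[p] (G ⧸ N.toSubgroup) →ₗ[ℤ_[p]] Additive (DerivedLevel V) :=
    (LinearMap.applyₗ (DerivedLevel.proj V u)).comp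
      (((DerivedLevel.rep p V).asAlgebraHom.comp (MonoidAlgebra.mapDomainAlgHom ℤ_[p] ℤ_[p]
        (QuotientGroup.map N.toSubgroup V.imageAb.toSubgroup
          (f : G →* TopologicalAbelianization F) le_rfl))).toLinearMap)
  have hL : (fun r : CompletedGroupAlgebra ℤ_[p] G =>
      DerivedLevel.proj V (CompletedGroupAlgebra.map ℤ_[p] f r • u)) =
      fun r => ∑ x, CompletedGroupAlgebra.coeffs r N x • L (MonoidAlgebra.single x 1) := by
    funext r
    rw [closedDerived.proj_smul]
    exact MonoidAlgebra.linearMap_apply_eq_sum L (r.1 N)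
  rw [hL]
  refine IsLocallyConstant.finset_sum _ _ fun x _ => ?_
  refine (DerivedLevel.isLocallyConstant_smul p V _).comp_continuous (f := fun r => CompletedGroupAlgebra.coeffs r N x) ?_
  exact (continuous_apply x).comp
    ((continuous_apply N).comp CompletedGroupAlgebra.continuous_coeffs)

theorem closedDerived.continuous_of_proj {F : Type*} [Group F] [TopologicalSpace F]
    [IsTopologicalGroup F] [CompactSpace F] [TotallyDisconnectedSpace F]
    {T : Type*} [TopologicalSpace T]
    (f : T → Additive (closedDerived F))
    (hf : ∀ V : OpenNormalSubgroup F, IsLocallyConstant fun t => DerivedLevel.proj V (f t)) :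
    Continuous fun t => ((f t).toMul : F) := by
  rw [continuous_iff_continuousAt]
  intro t U hU
  have hU' : (fun x => ((f t).toMul : F) * x) ⁻¹' U ∈ nhds (1 : F) := by
    apply (continuous_const_mul ((f t).toMul : F)).continuousAt
    simpa using hU
  obtain ⟨W, hWU, hW, h1⟩ := mem_nhds_iff.mp hU'
  obtain ⟨V, hV⟩ := ProfiniteGrp.exist_openNormalSubgroup_sub_open_nhds_of_one hW h1
  rw [Filter.mem_map]
  filter_upwards [(IsLocallyConstant.iff_eventually_eq _).mp (hf V) t] with t' ht'
  have h2 : ((f t).toMul : F)⁻¹ * ((f t').toMul : F) ∈ V.toSubgroup :=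
    (QuotientGroup.eq (s := V.toSubgroup.subgroupOf (closedDerived F))).mp ht'.symm
  have h3 := hWU (hV h2)
  simpa using h3

end Continuity

/-! ### Topological generation of free metabelian pro-`p` groups -/

theorem IsProP.exists_pow_mem {p : ℕ} {F : Type*} [Group F] [TopologicalSpace F]
    [IsTopologicalGroup F] [CompactSpace F] [TotallyDisconnectedSpace F] [hF : IsProP p F]
    {U : Set F} (hU : IsOpen U) (h1 : (1 : F) ∈ U) (x : F) : ∃ n : ℕ, x ^ p ^ n ∈ U := by
  obtain ⟨V, hV⟩ := ProfiniteGrp.exist_openNormalSubgroup_sub_open_nhds_of_one hU h1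
  obtain ⟨n, hn⟩ := hF.isPGroup V (x : F ⧸ V.toSubgroup)
  exact ⟨n, hV ((QuotientGroup.eq_one_iff _).mp hn)⟩

theorem IsProP.of_isClosed {p : ℕ} {F : Type*} [Group F] [TopologicalSpace F]
    [IsTopologicalGroup F] [CompactSpace F] [TotallyDisconnectedSpace F] [IsProP p F]
    (K : Subgroup F) [CompactSpace K] : IsProP p K := ⟨by
  intro N y
  obtain ⟨x, rfl⟩ := QuotientGroup.mk_surjective y
  obtain ⟨U, hU, hUN⟩ := isOpen_induced_iff.mp N.isOpen'
  have h1 : (1 : F) ∈ U := by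
    have : (1 : K) ∈ Subtype.val ⁻¹' U := by rw [hUN]; exact N.one_mem
    exact this
  obtain ⟨n, hn⟩ := IsProP.exists_pow_mem (p := p) hU h1 (x : F)
  refine ⟨n, ?_⟩
  rw [← QuotientGroup.mk_pow, QuotientGroup.eq_one_iff]
  have : x ^ p ^ n ∈ Subtype.val ⁻¹' U := hn
  rw [hUN] at this
  exact this⟩

theorem IsMetabelian.of_injective {F K : Type*} [Group F] [hF : IsMetabelian F] [Group K]
    (f : K →* F) (hf : Function.Injective f) : IsMetabelian K := ⟨by
  rw [eq_bot_iff]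
  intro x hx
  have : f x ∈ derivedSeries F 2 := map_derivedSeries_le_derivedSeries f 2 ⟨x, hx, rfl⟩
  rw [hF.derivedSeries_two, Subgroup.mem_bot] at this
  exact hf (this.trans (map_one f).symm)⟩

/-- A closed subgroup is again metabelian pro-`p`, so freeness gives a map `F → K` fixing the `g i`.
Followed by the inclusion it is the identity, by uniqueness. -/
theorem IsFreeMetabelianProP.eq_top_of_isClosed {p : ℕ} {ι : Type*} {F : Type u} [Group F]
    [TopologicalSpace F] [IsTopologicalGroup F] [CompactSpace F] [TotallyDisconnectedSpace F]
    [IsProP p F] [IsMetabelian F] {g : ι → F} (hF : IsFreeMetabelianProP p g) (K : Subgroup F)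
    (hK : IsClosed (K : Set F)) (hg : ∀ i, g i ∈ K) : K = ⊤ := by
  have : CompactSpace K := isCompact_iff_compactSpace.mp hK.isCompact
  have : IsProP p K := IsProP.of_isClosed K
  have : IsMetabelian K := IsMetabelian.of_injective K.subtype K.subtype_injective
  obtain ⟨φ, hφ, -⟩ := hF K fun i => ⟨g i, hg i⟩
  have h := (hF F g).unique (y₁ := (inclusionHom K).comp φ)
    (y₂ := ContinuousMonoidHom.id F) (fun i => congrArg Subtype.val (hφ i)) (fun i => rfl)
  rw [eq_top_iff]
  intro x _
  have hx : ((φ x : K) : F) = x := DFunLike.congr_fun h x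
  rw [← hx]
  exact (φ x).2

theorem commutator_le_of_generators {ι F : Type*} [Group F] [TopologicalSpace F]
    [IsTopologicalGroup F] {g : ι → F}
    (hg : ∀ K : Subgroup F, IsClosed (K : Set F) → (∀ i, g i ∈ K) → K = ⊤)
    (P : Subgroup F) (hP : IsClosed (P : Set F))
    (hconj : ∀ i, ∀ s ∈ P, (g i)⁻¹ * s * g i ∈ P ∧ g i * s * (g i)⁻¹ ∈ P)
    (hcomm : ∀ i j, (g i)⁻¹ * (g j)⁻¹ * g i * g j ∈ P) : commutator F ≤ P := by
  -- Elements normalising `P`. Both directions of conjugation are required so that `K` is closed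
  -- under inverses.
  let K : Subgroup F :=
    { carrier := {f | ∀ s ∈ P, f⁻¹ * s * f ∈ P ∧ f * s * f⁻¹ ∈ P}
      one_mem' := by simp
      mul_mem' := by
        intro x y hx hy s hs
        constructor
        · have := (hy _ (hx s hs).1).1
          rwa [show (x * y)⁻¹ * s * (x * y) = y⁻¹ * (x⁻¹ * s * x) * y by group]
        · have := (hx _ (hy s hs).2).2
          rwa [show x * y * s * (x * y)⁻¹ = x * (y * s * y⁻¹) * x⁻¹ by group]
      inv_mem' := by
        intro x hx s hs
        rw [inv_inv]
        exact (hx s hs).symm }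
  have hK : K = ⊤ := by
    refine hg K ?_ hconj
    change IsClosed {f : F | ∀ s ∈ P, f⁻¹ * s * f ∈ P ∧ f * s * f⁻¹ ∈ P}
    simp only [Set.ofPred_forall]
    exact isClosed_iInter fun s => isClosed_iInter fun _ =>
      (hP.preimage (by fun_prop)).inter (hP.preimage (by fun_prop))
  have hPn : P.Normal := ⟨fun s hs f => by
    have : f ∈ K := hK ▸ Subgroup.mem_top f
    exact (this s hs).2⟩
  -- Elements commuting with `h` modulo `P`. The generation hypothesis is used twice: for `h = g i`,
  -- and then, since commuting is symmetric, for arbitrary `h`.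
  let Z : F → Subgroup F := fun h =>
    (Subgroup.centralizer {(h : F ⧸ P)}).comap (QuotientGroup.mk' P)
  have hZ : ∀ h f, f ∈ Z h ↔ h⁻¹ * f⁻¹ * h * f ∈ P := by
    intro h f
    rw [Subgroup.mem_comap, Subgroup.mem_centralizer_singleton_iff]
    change ((f * h : F) : F ⧸ P) = ((h * f : F) : F ⧸ P) ↔ _
    rw [QuotientGroup.eq, mul_inv_rev]
    simp only [mul_assoc]
  have hZc : ∀ h, IsClosed (Z h : Set F) := by
    intro h
    have : (Z h : Set F) = (fun f => h⁻¹ * f⁻¹ * h * f) ⁻¹' (P : Set F) := Set.ext (hZ h)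
    rw [this]
    exact hP.preimage (by fun_prop)
  have hZg : ∀ i, Z (g i) = ⊤ := fun i =>
    hg _ (hZc _) fun j => (hZ _ _).mpr (hcomm i j)
  have hZf : ∀ f, Z f = ⊤ := fun f => by
    refine hg _ (hZc _) fun i => ?_
    have : f ∈ Z (g i) := hZg i ▸ Subgroup.mem_top f
    rw [hZ] at this ⊢
    simpa [mul_assoc] using P.inv_mem this
  rw [commutator_def, Subgroup.commutator_le]
  intro x _ y _
  have : y⁻¹ ∈ Z x⁻¹ := hZf x⁻¹ ▸ Subgroup.mem_top _
  rw [hZ] at this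
  simpa [commutatorElement_def, mul_assoc] using this

/-! ### The action of group elements and the Jacobi identity -/

section Existence

variable (p : ℕ) [Fact p.Prime] {F : Type*} [Group F] [TopologicalSpace F] [IsTopologicalGroup F]
  [CompactSpace F] [TotallyDisconnectedSpace F] [IsProP p F] [IsMetabelian F]

open CompletedGroupAlgebra

theorem closedDerived.of_smul (x : TopologicalAbelianization F) (a : Additive (closedDerived F)) :
    of ℤ_[p] x • a = Additive.ofMul (conjAction x a.toMul) :=
  closedDerived.ext_proj fun V => by
    rw [closedDerived.proj_smul]
    change (DerivedLevel.rep p V).asAlgebraHom (MonoidAlgebra.single _ 1) _ = _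
    rw [Representation.asAlgebraHom_single, one_smul]
    rfl

theorem closedDerived.coe_of_smul (f : F) (a : Additive (closedDerived F)) :
    ((of ℤ_[p] (f : TopologicalAbelianization F) • a).toMul : F) =
      f⁻¹ * (a.toMul : F) * f := by
  rw [closedDerived.of_smul]
  change f⁻¹ * (a.toMul : F) * f⁻¹⁻¹ = _
  rw [inv_inv]

variable {d : ℕ} (g : Fin d → F)

theorem basicCommutator_jacobi (i j k : Fin d) :
    (of ℤ_[p] (g k : TopologicalAbelianization F) - 1) • basicCommutator g i j =
      (of ℤ_[p] (g j : TopologicalAbelianization F) - 1) • basicCommutator g i k -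
        (of ℤ_[p] (g i : TopologicalAbelianization F) - 1) • basicCommutator g j k := by
  -- Two expansions of `[g_i g_j, g_k]`, by `[xy, z] = [x, z]^y [y, z]` and by `g_i g_j = g_j g_i
  -- u_ij`. The summands are ordered so that the equation already holds in the free group.
  have key : of ℤ_[p] (g j : TopologicalAbelianization F) • basicCommutator g i k +
      basicCommutator g j k = -basicCommutator g i j +
        (of ℤ_[p] (g i : TopologicalAbelianization F) • basicCommutator g j k +
          basicCommutator g i k) +
        of ℤ_[p] (g k : TopologicalAbelianization F) • basicCommutator g i j := by
    apply Additive.toMul.injective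
    apply Subtype.ext
    simp only [toMul_add, toMul_neg, Subgroup.coe_mul, closedDerived.coe_of_smul]
    change _ * ((g j)⁻¹ * (g k)⁻¹ * g j * g k) = ((g i)⁻¹ * (g j)⁻¹ * g i * g j)⁻¹ * _ * _
    simp only [basicCommutator, toMul_ofMul]
    group
  simp only [sub_smul, one_smul]
  rw [← sub_eq_zero]
  refine Eq.trans ?_ (neg_eq_zero.mpr (sub_eq_zero.mpr key))
  abel

/-! ### Existence of the normal form -/

theorem eq_one_add_neg_mul_sub_one {R : Type*} [Ring R] {a b : R} (h : b * a = 1) :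
    b = 1 + -b * (a - 1) := by
  rw [mul_sub, neg_mul, h]
  simp

/-- The map `(r_ij) ↦ ∑ u_ij r_ij`. -/
def normalFormMap :
    ((ij : {ij : Fin d × Fin d // ij.1 < ij.2}) →
      CompletedGroupAlgebra ℤ_[p] (closedSpan g ij.1.2)) →+ Additive (closedDerived F) where
  toFun r := ∑ ij : {ij : Fin d × Fin d // ij.1 < ij.2},
    map ℤ_[p] (inclusionHom (closedSpan g ij.1.2)) (r ij) • basicCommutator g ij.1.1 ij.1.2
  map_zero' := by simp
  map_add' r s := by simp [add_smul, Finset.sum_add_distrib]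

/-- The image of `R_j = ℤ_p[[X_j]]` in `ℤ_p[[X]]`. -/
def spanAlgebra {F : Type*} [Group F] [TopologicalSpace F] [IsTopologicalGroup F]
    (g : Fin d → F) (j : Fin d) :
    Subalgebra ℤ_[p] (CompletedGroupAlgebra ℤ_[p] (TopologicalAbelianization F)) :=
  (map ℤ_[p] (inclusionHom (closedSpan g j))).range

theorem smul_basicCommutator_mem_range {i j : Fin d} (hij : i < j)
    {t : CompletedGroupAlgebra ℤ_[p] (TopologicalAbelianization F)}
    (ht : t ∈ spanAlgebra p g j) :
    t • basicCommutator g i j ∈ (normalFormMap p g).range := by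
  obtain ⟨r, rfl⟩ := ht
  refine ⟨Pi.single ⟨(i, j), hij⟩ r, ?_⟩
  refine (Finset.sum_eq_single (⟨(i, j), hij⟩ : {ij : Fin d × Fin d // ij.1 < ij.2}) ?_ ?_).trans ?_
  · intro kl _ hkl
    rw [Pi.single_eq_of_ne hkl, map_zero, zero_smul]
  · exact fun h => absurd (Finset.mem_univ _) h
  · rw [Pi.single_eq_same]
    rfl

theorem mem_closedSpan {F : Type*} [Group F] [TopologicalSpace F] [IsTopologicalGroup F]
    (g : Fin d → F) {i j : Fin d} (h : i ≤ j) :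
    (g i : TopologicalAbelianization F) ∈ closedSpan g j :=
  Subgroup.le_topologicalClosure _ (Subgroup.subset_closure ⟨i, h, rfl⟩)

theorem closedSpan_mono {F : Type*} [Group F] [TopologicalSpace F] [IsTopologicalGroup F]
    (g : Fin d → F) {i j : Fin d} (h : i ≤ j) : closedSpan g i ≤ closedSpan g j :=
  Subgroup.topologicalClosure_mono
    (Subgroup.closure_mono (Set.image_mono (Set.Iic_subset_Iic.mpr h)))

theorem of_mem_spanAlgebra {F : Type*} [Group F] [TopologicalSpace F] [IsTopologicalGroup F]
    (g : Fin d → F) {j : Fin d} {x : TopologicalAbelianization F}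
    (hx : x ∈ closedSpan g j) : of ℤ_[p] x ∈ spanAlgebra p g j :=
  ⟨of ℤ_[p] ⟨x, hx⟩, map_of _ _⟩

theorem spanAlgebra_mono {F : Type*} [Group F] [TopologicalSpace F] [IsTopologicalGroup F]
    (g : Fin d → F) {i j : Fin d} (h : i ≤ j) :
    spanAlgebra p g i ≤ spanAlgebra p g j := by
  rintro _ ⟨r, rfl⟩
  let f : closedSpan g i →ₜ* closedSpan g j :=
    { toMonoidHom := Subgroup.inclusion (closedSpan_mono g h)
      continuous_toFun := continuous_inclusion (closedSpan_mono g h) }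
  exact ⟨map ℤ_[p] f r, map_map f (inclusionHom (closedSpan g j)) r⟩

/-- This is the rewriting step of the normal form. The inverses of the generators are included
because stability under the generators alone does not give a normal subgroup. -/
theorem of_smul_mem_range (k : Fin d) (y : TopologicalAbelianization F)
    (hy : y = g k ∨ y = (g k : TopologicalAbelianization F)⁻¹)
    {a : Additive (closedDerived F)} (ha : a ∈ (normalFormMap p g).range) :
    of ℤ_[p] y • a ∈ (normalFormMap p g).range := by
  have hmem : ∀ {l}, k ≤ l → of ℤ_[p] y ∈ spanAlgebra p g l := fun {l} h => by
    apply of_mem_spanAlgebra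
    rcases hy with rfl | rfl
    · exact mem_closedSpan g h
    · exact inv_mem (mem_closedSpan g h)
  -- Both `x_k` and its inverse differ from `1` by a multiple of `x_k - 1`, which brings them within
  -- reach of the Jacobi identity.
  have hw : ∃ w ∈ spanAlgebra p g k,
      of ℤ_[p] y = 1 + w * (of ℤ_[p] (g k : TopologicalAbelianization F) - 1) := by
    rcases hy with rfl | rfl
    · exact ⟨1, one_mem _, by simp⟩
    · refine ⟨-of ℤ_[p] (g k : TopologicalAbelianization F)⁻¹, neg_mem (hmem le_rfl), ?_⟩
      exact eq_one_add_neg_mul_sub_one (by rw [← map_mul, inv_mul_cancel, map_one])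
  obtain ⟨w, hwk, hwy⟩ := hw
  obtain ⟨r, rfl⟩ := ha
  change of ℤ_[p] y • ∑ ij : {ij : Fin d × Fin d // ij.1 < ij.2}, _ ∈ _
  rw [Finset.smul_sum]
  refine sum_mem fun ij _ => ?_
  obtain ⟨⟨i, j⟩, hij⟩ := ij
  replace hij : i < j := hij
  have ht : map ℤ_[p] (inclusionHom (closedSpan g j)) (r ⟨(i, j), hij⟩) ∈ spanAlgebra p g j :=
    ⟨_, rfl⟩
  change of ℤ_[p] y • map ℤ_[p] (inclusionHom (closedSpan g j)) (r ⟨(i, j), hij⟩) •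
    basicCommutator g i j ∈ _
  generalize map ℤ_[p] (inclusionHom (closedSpan g j)) (r ⟨(i, j), hij⟩) = t at ht
  rw [smul_smul, of_mul_comm (fun x y => mul_comm x y)]
  rcases le_or_gt k j with hkj | hjk
  · exact smul_basicCommutator_mem_range p g hij (mul_mem ht (hmem hkj))
  · have htk := mul_mem (spanAlgebra_mono p g hjk.le ht) hwk
    have hof : ∀ l, l ≤ k → of ℤ_[p] (g l : TopologicalAbelianization F) - 1 ∈ spanAlgebra p g k :=
      fun l hl => sub_mem (of_mem_spanAlgebra p g (mem_closedSpan g hl)) (one_mem _)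
    -- With `j < k`, the term becomes `t u_ij + t w ((x_j - 1) u_ik - (x_i - 1) u_jk)`; the new
    -- coefficients lie in `R_k`, as `u_ik` and `u_jk` require.
    rw [hwy, mul_add, mul_one, ← mul_assoc, add_smul, mul_smul (t * w), basicCommutator_jacobi,
      smul_sub, smul_smul, smul_smul]
    exact add_mem (smul_basicCommutator_mem_range p g hij ht)
      (sub_mem (smul_basicCommutator_mem_range p g (hij.trans hjk)
        (mul_mem htk (hof j hjk.le)))
        (smul_basicCommutator_mem_range p g hjk (mul_mem htk (hof i (hij.trans hjk).le))))

section Closed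

attribute [local instance] coeffTopology

/-- The domain is compact and the map to `F` is continuous, being locally constant modulo each open
normal subgroup. -/
theorem isClosed_range_normalFormMap :
    IsClosed (Set.range fun r => ((normalFormMap p g r).toMul : F)) := by
  have hc : ∀ j, CompactSpace (closedSpan g j) := fun j =>
    isCompact_iff_compactSpace.mp (Subgroup.isClosed_topologicalClosure _).isCompact
  have := fun j => CompletedGroupAlgebra.compactSpace (k := ℤ_[p]) (G := closedSpan g j)
  refine (isCompact_range (closedDerived.continuous_of_proj _ fun V => ?_)).isClosed
  have : (fun r => DerivedLevel.proj V (normalFormMap p g r)) =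
      fun r => ∑ ij : {ij : Fin d × Fin d // ij.1 < ij.2}, DerivedLevel.proj V
        (map ℤ_[p] (inclusionHom (closedSpan g ij.1.2)) (r ij) •
          basicCommutator g ij.1.1 ij.1.2) := by
    funext r
    exact map_sum _ _ _
  rw [this]
  refine IsLocallyConstant.finset_sum _ _ fun ij _ => ?_
  exact (closedDerived.isLocallyConstant_proj_map_smul p (inclusionHom (closedSpan g ij.1.2))
    (basicCommutator g ij.1.1 ij.1.2) V).comp_continuous (continuous_apply ij)

end Closed

theorem normalFormMap_surjective
    (hg : ∀ K : Subgroup F, IsClosed (K : Set F) → (∀ i, g i ∈ K) → K = ⊤) :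
    Function.Surjective (normalFormMap p g) := by
  let P : Subgroup F :=
    { carrier := Set.range fun r => ((normalFormMap p g r).toMul : F)
      one_mem' := ⟨0, by simp⟩
      mul_mem' := by
        rintro _ _ ⟨r, rfl⟩ ⟨s, rfl⟩
        exact ⟨r + s, by simp⟩
      inv_mem' := by
        rintro _ ⟨r, rfl⟩
        exact ⟨-r, by simp⟩ }
  have hmem : ∀ {a : Additive (closedDerived F)}, a ∈ (normalFormMap p g).range →
      (a.toMul : F) ∈ P := by
    rintro _ ⟨r, rfl⟩
    exact ⟨r, rfl⟩
  have hu : ∀ {i j}, i < j → (g i)⁻¹ * (g j)⁻¹ * g i * g j ∈ P := fun {i j} hij => by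
    have := hmem (smul_basicCommutator_mem_range p g hij (one_mem (spanAlgebra p g j)))
    rw [one_smul] at this
    exact this
  have hle : closedDerived F ≤ P := by
    refine Subgroup.topologicalClosure_minimal _ ?_ (isClosed_range_normalFormMap p g)
    refine commutator_le_of_generators hg P (isClosed_range_normalFormMap p g) ?_ ?_
    · rintro i _ ⟨r, rfl⟩
      constructor
      · have := hmem (of_smul_mem_range p g i (g i) (Or.inl rfl) ⟨r, rfl⟩)
        rwa [closedDerived.coe_of_smul] at this
      · have := hmem (of_smul_mem_range p g i ((g i)⁻¹ : F) (Or.inr rfl) ⟨r, rfl⟩)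
        rwa [closedDerived.coe_of_smul, inv_inv] at this
    · intro i j
      rcases lt_trichotomy i j with h | rfl | h
      · exact hu h
      · simp
      · simpa [mul_assoc] using P.inv_mem (hu h)
  intro a
  obtain ⟨r, hr⟩ := hle a.toMul.2
  exact ⟨r, Additive.toMul.injective (Subtype.ext hr)⟩

end Existence

/-! ### Elements of finite group algebras fixed by translation -/

theorem sum_eq_card_nsmul_sum_quotient {G M : Type*} [Group G] [Fintype G] [AddCommMonoid M]
    (T : Subgroup G) (h : G → M) (hh : ∀ g, ∀ t ∈ T, h (g * t) = h g) :
    ∃ m : M, ∑ g, h g = Nat.card T • m := by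
  classical
  have : Fintype T := Fintype.ofFinite _
  have : Fintype (G ⧸ T) := Fintype.ofFinite _
  have hout : ∀ g : G, h g = h (g : G ⧸ T).out := fun g => by
    obtain ⟨t, ht⟩ := QuotientGroup.mk_out_eq_mul T g
    rw [ht, hh g t t.2]
  refine ⟨∑ q : G ⧸ T, h q.out, ?_⟩
  calc ∑ g, h g = ∑ g, h ((Subgroup.groupEquivQuotientProdSubgroup (s := T) g).1).out :=
        Finset.sum_congr rfl fun g _ => hout g
    _ = ∑ z : (G ⧸ T) × T, h z.1.out :=
        Equiv.sum_comp Subgroup.groupEquivQuotientProdSubgroup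
          fun z : (G ⧸ T) × T => h z.1.out
    _ = _ := by
        rw [Fintype.sum_prod_type]
        simp [Finset.smul_sum]

/-- The coefficients of `s` are invariant under translation by `x`, and `f` is constant on cosets of
`⟨x ^ a⟩`. Summing over these cosets makes the image a multiple of the order of `⟨x ^ a⟩`, which is
zero in `k`. -/
theorem MonoidAlgebra.mapDomain_eq_zero_of_translation_fixed {k G Q : Type*} [CommRing k]
    [CommGroup G] [Finite G] [CommGroup Q] (f : G →* Q) (x : G) (s : MonoidAlgebra k G)
    (hs : (MonoidAlgebra.single x 1 - 1) * s = 0) (a : ℕ) (hf : f (x ^ a) = 1)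
    (hc : (Nat.card (Subgroup.zpowers (x ^ a)) : k) = 0) :
    MonoidAlgebra.mapDomainAlgHom k k f s = 0 := by
  have : Fintype G := Fintype.ofFinite _
  have hx : ∀ g, s.coeff (g * x) = s.coeff g := fun g => by
    rw [sub_mul, one_mul, sub_eq_zero] at hs
    conv_rhs => rw [← one_mul (s.coeff g)]
    rw [← MonoidAlgebra.coeff_single_mul_eq_mul_coeff (m := x) (m₁ := g * x) g, hs]
    intro m _
    rw [mul_comm, mul_left_inj]
  have hx' : ∀ (n : ℕ) g, s.coeff (g * x ^ n) = s.coeff g := fun n => by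
    induction n with
    | zero => simp
    | succ n ih => intro g; rw [pow_succ, ← mul_assoc, hx, ih]
  obtain ⟨m, hm⟩ := sum_eq_card_nsmul_sum_quotient (Subgroup.zpowers (x ^ a))
    (fun g => s.coeff g • MonoidAlgebra.mapDomainAlgHom k k f (MonoidAlgebra.single g 1)) (by
      intro g t ht
      obtain ⟨n, rfl⟩ := (mem_powers_iff_mem_zpowers.mpr ht)
      simp only [MonoidAlgebra.mapDomainAlgHom_apply, MonoidAlgebra.mapDomain_single, map_mul,
        map_pow, ← pow_mul]
      rw [hx', pow_mul, ← map_pow f, hf, one_pow, mul_one])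
  have h1 := MonoidAlgebra.linearMap_apply_eq_sum
    (MonoidAlgebra.mapDomainAlgHom k k f).toLinearMap s
  refine (h1.trans hm).trans ?_
  rw [← Nat.cast_smul_eq_nsmul k, hc, zero_smul]

/-! ### The Magnus representation -/

/-- The group of matrices `(y, 0; b, 1)`, where `y ∈ Y` is viewed as an element of `B` by means of
a homomorphism `χ`. -/
@[ext]
structure MagnusGroup {Y B : Type*} [CommGroup Y] [CommRing B] (χ : Y →* B) where
  y : Y
  b : B

namespace MagnusGroup

variable {Y B : Type*} [CommGroup Y] [CommRing B] {χ : Y →* B}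

theorem map_mul_map_inv (χ : Y →* B) (y : Y) : χ y * χ y⁻¹ = 1 := by
  rw [← map_mul, mul_inv_cancel, map_one]

instance : Mul (MagnusGroup χ) := ⟨fun g h => ⟨g.y * h.y, χ h.y * g.b + h.b⟩⟩
instance : One (MagnusGroup χ) := ⟨⟨1, 0⟩⟩
instance : Inv (MagnusGroup χ) := ⟨fun g => ⟨g.y⁻¹, -(χ g.y⁻¹ * g.b)⟩⟩

@[simp] theorem mul_y (g h : MagnusGroup χ) : (g * h).y = g.y * h.y := rfl
@[simp] theorem mul_b (g h : MagnusGroup χ) : (g * h).b = χ h.y * g.b + h.b := rfl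
@[simp] theorem one_y : (1 : MagnusGroup χ).y = 1 := rfl
@[simp] theorem one_b : (1 : MagnusGroup χ).b = 0 := rfl
@[simp] theorem inv_y (g : MagnusGroup χ) : g⁻¹.y = g.y⁻¹ := rfl
@[simp] theorem inv_b (g : MagnusGroup χ) : g⁻¹.b = -(χ g.y⁻¹ * g.b) := rfl

instance : Group (MagnusGroup χ) where
  mul_assoc g h k := by
    ext
    · simp [mul_assoc]
    · simp
      ring
  one_mul g := by ext <;> simp
  mul_one g := by ext <;> simp
  inv_mul_cancel g := by
    ext
    · simp
    · simp only [mul_b, inv_b, one_b]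
      linear_combination (-g.b) * map_mul_map_inv χ g.y

/-- The projection to `Y`. -/
def toY (χ : Y →* B) : MagnusGroup χ →* Y where
  toFun := y
  map_one' := rfl
  map_mul' _ _ := rfl

theorem conj_b (g h : MagnusGroup χ) (hh : h.y = 1) : (g⁻¹ * h * g).b = χ g.y * h.b := by
  simp only [mul_b, inv_b, hh, map_one]
  linear_combination (-g.b) * map_mul_map_inv χ g.y

theorem commutator_b (g h : MagnusGroup χ) :
    (g⁻¹ * h⁻¹ * g * h).b = (χ h.y - 1) * g.b - (χ g.y - 1) * h.b := by
  simp only [mul_b, inv_b, inv_y]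
  linear_combination (-g.b * χ h.y * χ h.y⁻¹) * map_mul_map_inv χ g.y -
    (g.b + χ g.y * h.b) * map_mul_map_inv χ h.y

instance [Finite Y] [Finite B] : Finite (MagnusGroup χ) :=
  Finite.of_injective (fun g : MagnusGroup χ => (g.y, g.b)) fun g h e => by
    ext
    · exact congrArg Prod.fst e
    · exact congrArg Prod.snd e

instance : IsMetabelian (MagnusGroup χ) := ⟨by
  have h1 : commutator (MagnusGroup χ) ≤ (toY χ).ker := Abelianization.commutator_subset_ker _
  rw [derivedSeries_succ, derivedSeries_one, eq_bot_iff, Subgroup.commutator_le]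
  intro g hg h hh
  have hg' : g.y = 1 := h1 hg
  have hh' : h.y = 1 := h1 hh
  rw [Subgroup.mem_bot, commutatorElement_eq_one_iff_mul_comm]
  ext
  · simp [hg', hh']
  · simp [hg', hh', add_comm]⟩

theorem pow_y (g : MagnusGroup χ) (n : ℕ) : (g ^ n).y = g.y ^ n := map_pow (toY χ) g n

theorem pow_b (g : MagnusGroup χ) (hg : g.y = 1) (n : ℕ) : (g ^ n).b = n • g.b := by
  induction n with
  | zero => simp
  | succ n ih => rw [pow_succ, mul_b, ih, hg, map_one, one_mul, succ_nsmul]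

theorem isPGroup {p l : ℕ} (hY : IsPGroup p Y) (hB : ∀ b : B, p ^ l • b = 0) :
    IsPGroup p (MagnusGroup χ) := by
  intro g
  obtain ⟨n, hn⟩ := hY g.y
  refine ⟨n + l, ?_⟩
  have h1 : (g ^ p ^ n).y = 1 := by rw [pow_y, hn]
  rw [pow_add, pow_mul]
  ext
  · rw [pow_y, h1, one_pow, one_y]
  · rw [pow_b _ h1, hB, one_b]

end MagnusGroup

theorem IsFreeMetabelianProP.exists_hom {p : ℕ} {ι : Type*} {F : Type u} [Group F]
    [TopologicalSpace F] {g : ι → F}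
    (hF : IsFreeMetabelianProP p g) (H : Type) [Group H] [Finite H] [IsMetabelian H]
    (hH : IsPGroup p H) (h : ι → H) :
    ∃ φ : F →* H, IsOpen (φ.ker : Set F) ∧ ∀ i, φ (g i) = h i := by
  -- The universal property only tests groups in the universe of `F`.
  let H' := ULift.{u} H
  let e : H' ≃* H := MulEquiv.ulift
  let _ : TopologicalSpace H' := ⊥
  have : DiscreteTopology H' := ⟨rfl⟩
  have : IsMetabelian H' := IsMetabelian.of_injective e.toMonoidHom e.injective
  have : IsProP p H' := ⟨fun N =>
    (hH.of_injective e.toMonoidHom e.injective).to_quotient N.toSubgroup⟩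
  obtain ⟨φ, hφ, -⟩ := hF H' fun i => e.symm (h i)
  refine ⟨e.toMonoidHom.comp (φ : F →* H'), ?_, fun i => ?_⟩
  · have : ((e.toMonoidHom.comp (φ : F →* H')).ker : Set F) = φ ⁻¹' {1} := by
      ext x
      exact e.map_eq_one_iff
    rw [this]
    exact (isOpen_discrete _).preimage φ.continuous_toFun
  · exact congrArg e (hφ i)

section Magnus

variable (p : ℕ) [Fact p.Prime] {F : Type*} [Group F] [TopologicalSpace F] [IsTopologicalGroup F]
  [CompactSpace F] [TotallyDisconnectedSpace F] [IsProP p F] [IsMetabelian F]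
  {Y B : Type*} [CommGroup Y] [CommRing B] [Algebra ℤ_[p] B] {χ : Y →* B}

open CompletedGroupAlgebra

/-- The homomorphism from `F/F'` to an abelian group induced by one with open kernel on `F`. -/
def abelianizationLift {F : Type*} [Group F] [TopologicalSpace F] [IsTopologicalGroup F]
    (θ : F →* Y) (hθ : IsOpen (θ.ker : Set F)) : TopologicalAbelianization F →* Y :=
  QuotientGroup.lift (closedDerived F) θ (Subgroup.topologicalClosure_minimal _
    (Abelianization.commutator_subset_ker θ) (θ.ker.isClosed_of_isOpen hθ))

theorem isOpen_ker_abelianizationLift {F : Type*} [Group F] [TopologicalSpace F]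
    [IsTopologicalGroup F] (θ : F →* Y) (hθ : IsOpen (θ.ker : Set F)) :
    IsOpen ((abelianizationLift θ hθ).ker : Set (TopologicalAbelianization F)) := by
  rw [← QuotientGroup.isOpenQuotientMap_mk.isQuotientMap.isOpen_preimage]
  exact hθ

theorem MagnusGroup.isOpen_ker_toY_comp {F : Type*} [Group F] [TopologicalSpace F]
    [IsTopologicalGroup F] {φ : F →* MagnusGroup χ} (hφ : IsOpen (φ.ker : Set F)) :
    IsOpen (((MagnusGroup.toY χ).comp φ).ker : Set F) :=
  Subgroup.isOpen_mono (fun x hx => by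
    rw [MonoidHom.mem_ker] at hx ⊢
    rw [MonoidHom.comp_apply, hx, map_one]) hφ

theorem isOpen_ker_comp_of_isOpen_ker {G Y B : Type*} [Group G] [TopologicalSpace G]
    [SeparatelyContinuousMul G] [Group Y] [CommRing B] (χ : Y →* B) {ψ : G →* Y}
    (hψ : IsOpen (ψ.ker : Set G)) : IsOpen ((χ.comp ψ).ker : Set G) :=
  Subgroup.isOpen_mono (fun x hx => by
    rw [MonoidHom.mem_ker] at hx ⊢
    rw [MonoidHom.comp_apply, hx, map_one]) hψ

theorem MagnusGroup.apply_y_eq_one {F : Type*} [Group F] [TopologicalSpace F]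
    [IsTopologicalGroup F] {φ : F →* MagnusGroup χ} (hφ : IsOpen (φ.ker : Set F))
    (a : closedDerived F) : (φ a).y = 1 :=
  Subgroup.topologicalClosure_minimal _
    (Abelianization.commutator_subset_ker ((MagnusGroup.toY χ).comp φ))
    (Subgroup.isClosed_of_isOpen _ (MagnusGroup.isOpen_ker_toY_comp hφ)) a.2

/-- The restriction to `F'` of a homomorphism from `F` to a Magnus group. -/
def MagnusGroup.derivedHom {F : Type*} [Group F] [TopologicalSpace F] [IsTopologicalGroup F]
    [TotallyDisconnectedSpace F] [IsMetabelian F] (φ : F →* MagnusGroup χ)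
    (hφ : IsOpen (φ.ker : Set F)) : Additive (closedDerived F) →+ B where
  toFun a := (φ a.toMul).b
  map_zero' := by simp
  map_add' a c := by simp [MagnusGroup.apply_y_eq_one hφ]

/-- Both sides factor through the finite level of `φ.ker`, where linearity reduces the claim to
group elements; there it is `conj_b`. -/
theorem MagnusGroup.derivedHom_smul (φ : F →* MagnusGroup χ) (hφ : IsOpen (φ.ker : Set F))
    (r : CompletedGroupAlgebra ℤ_[p] (TopologicalAbelianization F))
    (a : Additive (closedDerived F)) :
    MagnusGroup.derivedHom φ hφ (r • a) =
      lift (χ.comp (abelianizationLift _ (MagnusGroup.isOpen_ker_toY_comp hφ)))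
        (isOpen_ker_comp_of_isOpen_ker χ (isOpen_ker_abelianizationLift _ _)) r *
          MagnusGroup.derivedHom φ hφ a := by
  obtain ⟨V, hV⟩ : ∃ V : OpenNormalSubgroup F, V.toSubgroup = φ.ker :=
    ⟨{ toSubgroup := φ.ker, isOpen' := hφ, isNormal' := inferInstance }, rfl⟩
  let φ' : Additive (DerivedLevel V) →+ B := MonoidHom.toAdditiveLeft
    (QuotientGroup.lift _ (AddMonoidHom.toMultiplicativeRight (MagnusGroup.derivedHom φ hφ)) (by
      intro c hc
      have hc' : (c : F) ∈ φ.ker := hV ▸ hc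
      rw [MonoidHom.mem_ker] at hc'
      change (φ c).b = 0
      rw [hc', MagnusGroup.one_b]))
  have hφ' : ∀ c, φ' (DerivedLevel.proj V c) = MagnusGroup.derivedHom φ hφ c := fun c => rfl
  rw [← hφ', closedDerived.proj_smul, lift_eq_of_le _ _ V.imageAb (by
    rintro _ ⟨f, hf, rfl⟩
    have hf' : f ∈ φ.ker := hV ▸ hf
    rw [MonoidHom.mem_ker] at hf'
    change χ (φ f).y = 1
    rw [hf', MagnusGroup.one_y, map_one])]
  change φ' ((DerivedLevel.rep p V).asAlgebraHom (r.1 V.imageAb) _) = _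
  generalize r.1 V.imageAb = s
  induction s using MonoidAlgebra.induction_linear with
  | zero => simp
  | add s t hs ht => simp only [map_add, LinearMap.add_apply, hs, ht, add_mul]
  | single x c =>
    obtain ⟨x, rfl⟩ := QuotientGroup.mk_surjective x
    obtain ⟨f, rfl⟩ := QuotientGroup.mk_surjective x
    rw [Representation.asAlgebraHom_single, LinearMap.smul_apply, DerivedLevel.map_padic_smul,
      MonoidAlgebra.lift_single, smul_mul_assoc]
    congr 1
    change (φ (f⁻¹ * (a.toMul : F) * f⁻¹⁻¹)).b = χ (φ f).y * (φ (a.toMul : F)).b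
    rw [inv_inv, map_mul, map_mul, map_inv,
      MagnusGroup.conj_b _ _ (MagnusGroup.apply_y_eq_one hφ _)]

end Magnus

/-! ### Relations between coefficients obtained from the Magnus representation -/

section Uniqueness

variable {p : ℕ} [Fact p.Prime] {F : Type u} [Group F] [TopologicalSpace F] [IsTopologicalGroup F]
  [CompactSpace F] [TotallyDisconnectedSpace F] [IsProP p F] [IsMetabelian F]

open CompletedGroupAlgebra

theorem IsFreeMetabelianProP.exists_magnus_relation {d : ℕ} {g : Fin d → F}
    (hF : IsFreeMetabelianProP p g)
    {Y B : Type} [CommGroup Y] [Finite Y] [CommRing B] [Finite B] [Algebra ℤ_[p] B] (χ : Y →* B)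
    (hY : IsPGroup p Y) {l : ℕ} (hB : ∀ b : B, p ^ l • b = 0) (y : Fin d → Y) (b : Fin d → B) :
    ∃ (ψ : TopologicalAbelianization F →* Y)
      (hψ : IsOpen (ψ.ker : Set (TopologicalAbelianization F))),
      (∀ i, ψ (g i) = y i) ∧ ∀ r, normalFormMap p g r = 0 →
        ∑ ij : {ij : Fin d × Fin d // ij.1 < ij.2},
          lift (χ.comp ψ) (isOpen_ker_comp_of_isOpen_ker χ hψ)
            (map ℤ_[p] (inclusionHom (closedSpan g ij.1.2)) (r ij)) *
            ((χ (y ij.1.2) - 1) * b ij.1.1 - (χ (y ij.1.1) - 1) * b ij.1.2) = 0 := by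
  obtain ⟨φ, hφ, hφg⟩ := hF.exists_hom (MagnusGroup χ) (MagnusGroup.isPGroup hY hB)
    fun i => ⟨y i, b i⟩
  refine ⟨abelianizationLift _ (MagnusGroup.isOpen_ker_toY_comp hφ),
    isOpen_ker_abelianizationLift _ _, fun i => ?_, fun r hr => ?_⟩
  · exact congrArg MagnusGroup.y (hφg i)
  · have h := congrArg (MagnusGroup.derivedHom φ hφ) hr
    rw [map_zero] at h
    change MagnusGroup.derivedHom φ hφ (∑ ij, _) = 0 at h
    rw [map_sum] at h
    rw [← h]
    refine Finset.sum_congr rfl fun ij _ => ?_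
    rw [MagnusGroup.derivedHom_smul]
    congr 1
    change _ = (φ ((g ij.1.1)⁻¹ * (g ij.1.2)⁻¹ * g ij.1.1 * g ij.1.2)).b
    rw [map_mul, map_mul, map_mul, map_inv, map_inv, MagnusGroup.commutator_b, hφg, hφg]

theorem closedSpan_le_eqLocus {F : Type*} [Group F] [TopologicalSpace F] [IsTopologicalGroup F]
    {d : ℕ} (g : Fin d → F) (j : Fin d) {Y : Type*} [Group Y]
    (ψ ψ' : TopologicalAbelianization F →* Y)
    (hψ : IsOpen (ψ.ker : Set (TopologicalAbelianization F)))
    (hψ' : IsOpen (ψ'.ker : Set (TopologicalAbelianization F)))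
    (h : ∀ i ≤ j, ψ (g i) = ψ' (g i)) : closedSpan g j ≤ ψ.eqLocus ψ' := by
  refine Subgroup.topologicalClosure_minimal _ ?_ (Subgroup.isClosed_of_isOpen _
    (Subgroup.isOpen_mono (H₁ := ψ.ker ⊓ ψ'.ker) (fun x hx => ?_) (hψ.inter hψ')))
  · rw [Subgroup.closure_le]
    rintro _ ⟨i, hi, rfl⟩
    exact h i hi
  · exact (MonoidHom.mem_ker.mp hx.1).trans (MonoidHom.mem_ker.mp hx.2).symm

/-- An element of `R_j` sees only the values at `x_1, …, x_j`, because the set where `ψ` and `ψ'`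
agree is a closed subgroup. Hence altering `y_m` leaves `R_j` with `j < m` untouched. -/
theorem lift_map_inclusionHom_congr {k F : Type*} [CommRing k] [Group F] [TopologicalSpace F]
    [IsTopologicalGroup F] {d : ℕ} (g : Fin d → F) (j : Fin d) {Y B : Type*} [Group Y] [CommRing B]
    [Algebra k B] (χ : Y →* B) (ψ ψ' : TopologicalAbelianization F →* Y)
    (hψ : IsOpen (ψ.ker : Set (TopologicalAbelianization F)))
    (hψ' : IsOpen (ψ'.ker : Set (TopologicalAbelianization F)))
    (h : ∀ i ≤ j, ψ (g i) = ψ' (g i)) (r : CompletedGroupAlgebra k (closedSpan g j)) :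
    lift (χ.comp ψ) (isOpen_ker_comp_of_isOpen_ker χ hψ)
        (map k (inclusionHom (closedSpan g j)) r) =
      lift (χ.comp ψ') (isOpen_ker_comp_of_isOpen_ker χ hψ')
        (map k (inclusionHom (closedSpan g j)) r) := by
  rw [lift_map, lift_map]
  refine algHom_lift (AlgHom.id k B) _ _ _ _ (fun x => ?_) r
  exact congrArg χ (closedSpan_le_eqLocus g j ψ ψ' hψ hψ' h x.2)

/-- If `∑ u_ij r_ij = 0` and `r_ij = 0` for all `j > m`, then `x_m - 1` kills the image of
`r_km` in any finite quotient of the group algebra. -/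
theorem IsFreeMetabelianProP.exists_sub_one_mul_eq_zero {d : ℕ} {g : Fin d → F}
    (hF : IsFreeMetabelianProP p g)
    {Y B : Type} [CommGroup Y] [Finite Y] [CommRing B] [Finite B] [Algebra ℤ_[p] B] (χ : Y →* B)
    (hY : IsPGroup p Y) {l : ℕ} (hB : ∀ b : B, p ^ l • b = 0) (y : Fin d → Y)
    {r : (ij : {ij : Fin d × Fin d // ij.1 < ij.2}) →
      CompletedGroupAlgebra ℤ_[p] (closedSpan g ij.1.2)}
    (hr : normalFormMap p g r = 0) {k m : Fin d} (hkm : k < m)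
    (hm : ∀ ij : {ij : Fin d × Fin d // ij.1 < ij.2}, m < ij.1.2 → r ij = 0) :
    ∃ (ψ : TopologicalAbelianization F →* Y)
      (hψ : IsOpen (ψ.ker : Set (TopologicalAbelianization F))), (∀ i, ψ (g i) = y i) ∧
        (χ (y m) - 1) * lift (χ.comp ψ) (isOpen_ker_comp_of_isOpen_ker χ hψ)
            (map ℤ_[p] (inclusionHom (closedSpan g m)) (r ⟨(k, m), hkm⟩)) = 0 := by
  -- Two relations that differ only in the value at `g m`; the value `1` in the second kills its
  -- `(k, m)` term.
  obtain ⟨ψ, hψ, hψy, hrel⟩ := hF.exists_magnus_relation χ hY hB y (Pi.single k 1)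
  obtain ⟨ψ', hψ', hψy', hrel'⟩ := hF.exists_magnus_relation χ hY hB (Function.update y m 1)
    (Pi.single k 1)
  refine ⟨ψ, hψ, hψy, ?_⟩
  have h := sub_eq_zero.mpr ((hrel r hr).trans (hrel' r hr).symm)
  rw [← Finset.sum_sub_distrib, Finset.sum_eq_single
    (⟨(k, m), hkm⟩ : {ij : Fin d × Fin d // ij.1 < ij.2})] at h
  · have hmk : m ≠ k := hkm.ne'
    simpa [hmk, mul_comm] using h
  · rintro ⟨⟨i, j⟩, hij⟩ - hne
    replace hij : i < j := hij
    rcases lt_trichotomy j m with hjm | rfl | hmj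
    · have hi : i ≠ m := (hij.trans hjm).ne
      simp only [Function.update_of_ne hjm.ne, Function.update_of_ne hi]
      rw [lift_map_inclusionHom_congr g j χ ψ ψ' hψ hψ', sub_self]
      intro a ha
      rw [hψy, hψy', Function.update_of_ne (ha.trans_lt hjm).ne]
    -- For `j = m` and `i ≠ k` both `b_i` and `b_m` vanish.
    · have hik : i ≠ k := by
        rintro rfl
        exact hne rfl
      simp [Pi.single_eq_of_ne hik, Pi.single_eq_of_ne hkm.ne']
    · simp [hm ⟨(i, j), hij⟩ hmj]
  · exact fun h => absurd (Finset.mem_univ _) h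

end Uniqueness

/-! ### Uniqueness of the normal form -/

theorem MonoidAlgebra.coeff_lift_of_injective {k A G Y : Type*} [CommRing k] [CommRing A]
    [Algebra k A] [Group G] [CommGroup Y] (ι : G →* Y) (hι : Function.Injective ι)
    (θ : G →* MonoidAlgebra A Y) (hθ : ∀ x, θ x = MonoidAlgebra.single (ι x) 1)
    (s : MonoidAlgebra k G) (x : G) :
    (MonoidAlgebra.lift k (MonoidAlgebra A Y) G θ s).coeff (ι x) =
      algebraMap k A (s.coeff x) := by
  classical
  induction s using MonoidAlgebra.induction_linear with
  | zero => simp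
  | add s t hs ht => simp [hs, ht]
  | single y c =>
    rw [MonoidAlgebra.lift_single, hθ]
    rcases eq_or_ne y x with rfl | hyx
    · simp [Algebra.algebraMap_eq_smul_one]
    · simp [hyx, hι.ne hyx]

/-- The group `(ℤ/p^n)^d`, written multiplicatively. -/
abbrev PrimePowerTorus (p d n : ℕ) : Type := Multiplicative (Fin d → ZMod (p ^ n))

/-! ### The finite test groups `(ℤ/p^n)^d` -/

namespace PrimePowerTorus

variable (p d : ℕ)

/-- The standard generators of `(ℤ/p^n)^d`. -/
def basis (n : ℕ) (i : Fin d) : PrimePowerTorus p d n := Multiplicative.ofAdd (Pi.single i 1)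

theorem isPGroup (n : ℕ) : IsPGroup p (PrimePowerTorus p d n) := fun y => ⟨n, by
  apply Multiplicative.toAdd.injective
  rw [toAdd_pow]
  funext i
  rw [Pi.smul_apply, nsmul_eq_mul, ZMod.natCast_self, zero_mul]
  rfl⟩

/-- Reduction modulo `p^n`. -/
def reduction (n l : ℕ) : PrimePowerTorus p d (n + l) →* PrimePowerTorus p d n :=
  AddMonoidHom.toMultiplicative (AddMonoidHom.compLeft
    (ZMod.castHom (pow_dvd_pow p (Nat.le_add_right n l)) (ZMod (p ^ n))).toAddMonoidHom (Fin d))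

theorem reduction_basis (n l : ℕ) (i : Fin d) :
    reduction p d n l (basis p d (n + l) i) = basis p d n i := by
  apply Multiplicative.toAdd.injective
  funext j
  change ZMod.castHom (pow_dvd_pow p (Nat.le_add_right n l)) (ZMod (p ^ n)) ((Pi.single i 1 : Fin d → ZMod (p ^ (n + l))) j) =
    (Pi.single i 1 : Fin d → ZMod (p ^ n)) j
  rcases eq_or_ne j i with rfl | hij
  · rw [Pi.single_eq_same, Pi.single_eq_same, map_one]
  · rw [Pi.single_eq_of_ne hij, Pi.single_eq_of_ne hij, map_zero]

theorem basis_zpow_prod (n : ℕ) (a : Fin d → ℤ) :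
    Multiplicative.toAdd (∏ i, basis p d n i ^ a i) = fun i => (a i : ZMod (p ^ n)) := by
  classical
  funext j
  rw [toAdd_prod, Finset.sum_apply, Finset.sum_eq_single j]
  · simp [basis]
  · intro i _ hij
    simp [basis, Pi.single_eq_of_ne hij.symm]
  · simp

theorem basis_pow_eq_one_iff (n : ℕ) (i : Fin d) (a : ℕ) :
    basis p d n i ^ a = 1 ↔ p ^ n ∣ a := by
  rw [← ZMod.natCast_eq_zero_iff]
  constructor
  · intro h
    have := congrFun (congrArg Multiplicative.toAdd h) i
    simpa [basis] using this
  · intro h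
    apply Multiplicative.toAdd.injective
    funext j
    rcases eq_or_ne j i with rfl | hij
    · simpa [basis] using h
    · simp [basis, Pi.single_eq_of_ne hij]

end PrimePowerTorus

section Uniqueness

variable {p : ℕ} [hp : Fact p.Prime]

open CompletedGroupAlgebra PrimePowerTorus

/-- `ℤ/p^l` as an algebra over `ℤ_p`. -/
abbrev zmodPowAlgebra (l : ℕ) : Algebra ℤ_[p] (ZMod (p ^ l)) :=
  (PadicInt.toZModPow (p := p) l).toAlgebra

attribute [local instance] zmodPowAlgebra

/-- The homomorphism `ℤ_p[[G]] → (ℤ/p^l)[Y]` induced by a homomorphism `G → Y` with open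
kernel. -/
def CompletedGroupAlgebra.modPowLift {G Y : Type*} [Group G] [TopologicalSpace G]
    [SeparatelyContinuousMul G] [CommGroup Y] (l : ℕ) (ψ : G →* Y)
    (hψ : IsOpen (ψ.ker : Set G)) :
    CompletedGroupAlgebra ℤ_[p] G →ₐ[ℤ_[p]] MonoidAlgebra (ZMod (p ^ l)) Y :=
  lift ((MonoidAlgebra.of (ZMod (p ^ l)) Y).comp ψ) (isOpen_ker_comp_of_isOpen_ker _ hψ)

/-- The power `x ^ p ^ n` of the `m`-th basis element reduces to `1`, and its order is a multiple of
`p ^ l`, hence zero in the coefficients. -/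
theorem mapDomain_reduction_eq_zero {d : ℕ} (m : Fin d) (n l : ℕ)
    (s : MonoidAlgebra (ZMod (p ^ l)) (PrimePowerTorus p d (n + l)))
    (hs : (MonoidAlgebra.of (ZMod (p ^ l)) _ (basis p d (n + l) m) - 1) * s = 0) :
    MonoidAlgebra.mapDomainAlgHom (ZMod (p ^ l)) (ZMod (p ^ l)) (reduction p d n l) s = 0 := by
  have : ∀ n, NeZero (p ^ n) := fun n => ⟨pow_ne_zero n hp.out.ne_zero⟩
  refine MonoidAlgebra.mapDomain_eq_zero_of_translation_fixed _ _ s hs (p ^ n) ?_ ?_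
  · rw [map_pow, reduction_basis, basis_pow_eq_one_iff]
  · rw [Nat.card_zpowers, ZMod.natCast_eq_zero_iff]
    have h := pow_orderOf_eq_one (basis p d (n + l) m ^ p ^ n)
    rw [← pow_mul, basis_pow_eq_one_iff] at h
    exact Nat.dvd_of_mul_dvd_mul_left (pow_pos hp.out.pos n) ((pow_add p n l).symm.dvd.trans h)

variable {F : Type u} [Group F] [TopologicalSpace F] [IsTopologicalGroup F]
  [CompactSpace F] [TotallyDisconnectedSpace F] [IsProP p F] [IsMetabelian F]

/-- The factor `x_m - 1` cannot be cancelled at level `n` itself, so the relation is taken at level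
`n + l` and then reduced. -/
theorem IsFreeMetabelianProP.exists_lift_eq_zero {d : ℕ} {g : Fin d → F}
    (hF : IsFreeMetabelianProP p g)
    {r : (ij : {ij : Fin d × Fin d // ij.1 < ij.2}) →
      CompletedGroupAlgebra ℤ_[p] (closedSpan g ij.1.2)}
    (hr : normalFormMap p g r = 0) {k m : Fin d} (hkm : k < m)
    (hm : ∀ ij : {ij : Fin d × Fin d // ij.1 < ij.2}, m < ij.1.2 → r ij = 0) (n l : ℕ) :
    ∃ (ψ : TopologicalAbelianization F →* PrimePowerTorus p d n)
      (hψ : IsOpen (ψ.ker : Set (TopologicalAbelianization F))),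
      (∀ i, ψ (g i) = basis p d n i) ∧
        modPowLift l ψ hψ
          (map ℤ_[p] (inclusionHom (closedSpan g m)) (r ⟨(k, m), hkm⟩)) = 0 := by
  have : ∀ n, NeZero (p ^ n) := fun n => ⟨pow_ne_zero n hp.out.ne_zero⟩
  have : Finite (MonoidAlgebra (ZMod (p ^ l)) (PrimePowerTorus p d (n + l))) :=
    Finite.of_equiv _ MonoidAlgebra.coeffEquiv.symm
  obtain ⟨ψ, hψ, hψg, h⟩ := hF.exists_sub_one_mul_eq_zero (l := l)
    (MonoidAlgebra.of (ZMod (p ^ l)) (PrimePowerTorus p d (n + l)))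
    (PrimePowerTorus.isPGroup p d (n + l)) (fun b => by
      rw [← Nat.cast_smul_eq_nsmul (ZMod (p ^ l)), ZMod.natCast_self, zero_smul])
    (basis p d (n + l)) hr hkm hm
  have hψ' : IsOpen (((reduction p d n l).comp ψ).ker : Set (TopologicalAbelianization F)) :=
    Subgroup.isOpen_mono (fun x hx => by
      rw [MonoidHom.mem_ker] at hx ⊢
      rw [MonoidHom.comp_apply, hx, map_one]) hψ
  refine ⟨(reduction p d n l).comp ψ, hψ', fun i => ?_, ?_⟩
  · rw [MonoidHom.comp_apply, hψg, reduction_basis]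
  · rw [modPowLift, ← algHom_lift (MonoidAlgebra.mapDomainAlgHom ℤ_[p] (ZMod (p ^ l)) (reduction p d n l))
      ((MonoidAlgebra.of (ZMod (p ^ l)) (PrimePowerTorus p d (n + l))).comp ψ)
      (isOpen_ker_comp_of_isOpen_ker _ hψ) _ _ (fun x => by simp)]
    exact mapDomain_reduction_eq_zero m n l _ h

/-! ### Detecting zero in `R_m` by the finite test groups -/

theorem exists_forall_pow_mem (p : ℕ) [Fact p.Prime] {F : Type*} [Group F] [TopologicalSpace F]
    [IsTopologicalGroup F] [CompactSpace F] [TotallyDisconnectedSpace F] [hF : IsProP p F]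
    (V : OpenNormalSubgroup F) : ∃ n, ∀ f : F, f ^ p ^ n ∈ V.toSubgroup := by
  have := V.finite_quotient
  obtain ⟨n, hn⟩ := IsPGroup.iff_card.mp (hF.isPGroup V)
  refine ⟨n, fun f => ?_⟩
  rw [← QuotientGroup.eq_one_iff, QuotientGroup.mk_pow, ← hn, pow_card_eq_one']

theorem exists_prod_zpow_of_mem_closure {G ι : Type*} [CommGroup G] [Fintype ι] (x : ι → G)
    {w : G} (hw : w ∈ Subgroup.closure (Set.range x)) : ∃ a : ι → ℤ, w = ∏ i, x i ^ a i := by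
  classical
  induction hw using Subgroup.closure_induction with
  | mem w hw =>
    obtain ⟨i, rfl⟩ := hw
    exact ⟨Pi.single i 1, by
      rw [Finset.prod_eq_single i] <;> simp +contextual⟩
  | one => exact ⟨0, by simp⟩
  | mul v w _ _ hv hw =>
    obtain ⟨a, rfl⟩ := hv
    obtain ⟨b, rfl⟩ := hw
    exact ⟨a + b, by simp [zpow_add, Finset.prod_mul_distrib]⟩
  | inv v _ hv =>
    obtain ⟨a, rfl⟩ := hv
    exact ⟨-a, by simp⟩

/-- The kernels of the maps `X_m → (ℤ/p^n)^d` are cofinal among the open subgroups of `X_m`. -/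
theorem exists_ker_le_openNormalSubgroup (p : ℕ) [Fact p.Prime] {F : Type*} [Group F]
    [TopologicalSpace F] [IsTopologicalGroup F] [CompactSpace F] [TotallyDisconnectedSpace F]
    [IsProP p F] {d : ℕ} (g : Fin d → F) (m : Fin d) (N : OpenNormalSubgroup (closedSpan g m)) :
    ∃ n, ∀ ψ : TopologicalAbelianization F →* PrimePowerTorus p d n,
      IsOpen (ψ.ker : Set (TopologicalAbelianization F)) → (∀ i, ψ (g i) = basis p d n i) →
        ∀ z : closedSpan g m, ψ z = 1 → z ∈ N.toSubgroup := by
  obtain ⟨U, hU, hUN⟩ := isOpen_induced_iff.mp N.isOpen'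
  have h1 : (1 : TopologicalAbelianization F) ∈ U := by
    have : (1 : closedSpan g m) ∈ Subtype.val ⁻¹' U := by rw [hUN]; exact N.one_mem
    exact this
  obtain ⟨V, hV⟩ := ProfiniteGrp.exist_openNormalSubgroup_sub_open_nhds_of_one
    (hU.preimage (QuotientGroup.continuous_mk (N := closedDerived F))) h1
  obtain ⟨n, hn⟩ := exists_forall_pow_mem p V
  refine ⟨n, fun ψ hψ hψg z hz => ?_⟩
  suffices h : (z : TopologicalAbelianization F) ∈ V.imageAb.toSubgroup by
    obtain ⟨v, hv, hvz⟩ := h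
    have : z ∈ Subtype.val ⁻¹' U := by
      change (z : TopologicalAbelianization F) ∈ U
      rw [← hvz]
      exact hV hv
    rw [hUN] at this
    exact this
  -- Approximate `z` by a word `w` in the generators, modulo both `V` and `ψ.ker`. From `ψ w = 1`
  -- all exponents of `w` are divisible by `p ^ n`, so `w` is a `p ^ n`-th power and lies in the
  -- image of `V`.
  obtain ⟨w, ⟨hwV, hwψ⟩, hw⟩ := mem_closure_iff.mp z.2
    ((fun w => w⁻¹ * (z : TopologicalAbelianization F)) ⁻¹'
      ((V.imageAb.toSubgroup : Set (TopologicalAbelianization F)) ∩ ψ.ker))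
    ((V.imageAb.isOpen'.inter hψ).preimage (by fun_prop))
    ⟨by simp [one_mem], by simp⟩
  obtain ⟨a, ha⟩ := exists_prod_zpow_of_mem_closure
    (fun i => (g i : TopologicalAbelianization F))
    (Subgroup.closure_mono (Set.image_subset_range _ _) hw)
  have hψw : ψ w = 1 := by
    have : ψ (w⁻¹ * z) = 1 := hwψ
    rw [map_mul, hz, mul_one, map_inv, inv_eq_one] at this
    exact this
  have hdvd : ∀ i, ((p ^ n : ℕ) : ℤ) ∣ a i := fun i => by
    rw [ha, map_prod] at hψw
    simp only [map_zpow, hψg] at hψw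
    have := congrFun ((basis_zpow_prod p d n a).symm.trans (congrArg Multiplicative.toAdd hψw)) i
    exact (ZMod.intCast_zmod_eq_zero_iff_dvd _ _).mp this
  choose b hb using hdvd
  have hwp : w = (∏ i, (g i : TopologicalAbelianization F) ^ b i) ^ p ^ n := by
    rw [ha, ← Finset.prod_pow]
    refine Finset.prod_congr rfl fun i _ => ?_
    rw [hb i, mul_comm, zpow_mul, zpow_natCast]
  have hwm : w ∈ V.imageAb.toSubgroup := by
    rw [hwp]
    obtain ⟨f, hf⟩ := QuotientGroup.mk_surjective
      (∏ i, (g i : TopologicalAbelianization F) ^ b i)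
    rw [← hf]
    exact ⟨f ^ p ^ n, hn f, rfl⟩
  have := V.imageAb.toSubgroup.mul_mem hwm hwV
  rwa [mul_inv_cancel_left] at this

/-- Since `G ⧸ K` embeds in `Y`, each coefficient of `t.1 K` can be read off modulo `p ^ l` from the
lift, and a `p`-adic integer that vanishes modulo every `p ^ l` is zero. -/
theorem CompletedGroupAlgebra.val_eq_zero_of_forall_lift_eq_zero {G Y : Type*} [Group G]
    [TopologicalSpace G] [SeparatelyContinuousMul G] [CommGroup Y] (θ : G →* Y)
    (hθ : IsOpen (θ.ker : Set G)) (t : CompletedGroupAlgebra ℤ_[p] G)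
    (ht : ∀ l, modPowLift l θ hθ t = 0)
    (K : OpenNormalSubgroup G) (hK : K.toSubgroup = θ.ker) : t.1 K = 0 := by
  let ι : G ⧸ K.toSubgroup →* Y := QuotientGroup.lift K.toSubgroup θ hK.le
  have hι : Function.Injective ι := by
    rw [injective_iff_map_eq_one]
    intro x hx
    obtain ⟨x, rfl⟩ := QuotientGroup.mk_surjective x
    rw [QuotientGroup.eq_one_iff, hK]
    exact hx
  apply MonoidAlgebra.coeff_injective
  ext x
  refine PadicInt.ext_of_toZModPow.mp fun l => ?_
  have h := ht l
  rw [modPowLift, lift_eq_of_le _ _ K (fun z hz => by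
    rw [hK, MonoidHom.mem_ker] at hz
    rw [MonoidHom.mem_ker, MonoidHom.comp_apply, hz, map_one])] at h
  have h2 := MonoidAlgebra.coeff_lift_of_injective (k := ℤ_[p]) (A := ZMod (p ^ l)) ι hι
    (QuotientGroup.lift K.toSubgroup ((MonoidAlgebra.of (ZMod (p ^ l)) Y).comp θ) (fun z hz => by
      rw [hK, MonoidHom.mem_ker] at hz
      rw [MonoidHom.mem_ker, MonoidHom.comp_apply, hz, map_one])) (fun y => by
      obtain ⟨y, rfl⟩ := QuotientGroup.mk_surjective y
      rfl) (t.1 K) x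
  rw [h] at h2
  exact h2.symm.trans (map_zero (PadicInt.toZModPow l)).symm

theorem eq_zero_of_forall_lift_map_eq_zero {F : Type*} [Group F] [TopologicalSpace F]
    [IsTopologicalGroup F] [CompactSpace F] [TotallyDisconnectedSpace F] [IsProP p F] {d : ℕ}
    (g : Fin d → F) (m : Fin d) (t : CompletedGroupAlgebra ℤ_[p] (closedSpan g m))
    (ht : ∀ n, ∃ (ψ : TopologicalAbelianization F →* PrimePowerTorus p d n)
      (hψ : IsOpen (ψ.ker : Set (TopologicalAbelianization F))),
      (∀ i, ψ (g i) = basis p d n i) ∧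
        ∀ l, modPowLift l ψ hψ (map ℤ_[p] (inclusionHom (closedSpan g m)) t) = 0) : t = 0 := by
  refine ext_val fun N => ?_
  obtain ⟨n, hn⟩ := exists_ker_le_openNormalSubgroup p g m N
  obtain ⟨ψ, hψ, hψg, hlift⟩ := ht n
  let θ : closedSpan g m →* PrimePowerTorus p d n :=
    ψ.comp (inclusionHom (closedSpan g m) : closedSpan g m →* TopologicalAbelianization F)
  have hθ : IsOpen (θ.ker : Set (closedSpan g m)) := hψ.preimage continuous_subtype_val
  obtain ⟨K, hK⟩ : ∃ K : OpenNormalSubgroup (closedSpan g m), K.toSubgroup = θ.ker :=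
    ⟨{ toSubgroup := θ.ker, isOpen' := hθ, isNormal' := inferInstance }, rfl⟩
  have hKN : K.toSubgroup ≤ N.toSubgroup := fun z hz => hn ψ hψ hψg z (by rw [hK] at hz; exact hz)
  have ht : t.1 K = 0 := by
    refine val_eq_zero_of_forall_lift_eq_zero θ hθ t (fun l => ?_) K hK
    have h := hlift l
    rw [modPowLift, lift_map] at h
    exact h
  rw [← t.2 K N hKN, ht, map_zero]
  rfl

theorem IsFreeMetabelianProP.eq_zero_of_forall_lt {d : ℕ} {g : Fin d → F}
    (hF : IsFreeMetabelianProP p g)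
    {r : (ij : {ij : Fin d × Fin d // ij.1 < ij.2}) →
      CompletedGroupAlgebra ℤ_[p] (closedSpan g ij.1.2)}
    (hr : normalFormMap p g r = 0) {k m : Fin d} (hkm : k < m)
    (hm : ∀ ij : {ij : Fin d × Fin d // ij.1 < ij.2}, m < ij.1.2 → r ij = 0) :
    r ⟨(k, m), hkm⟩ = 0 := by
  refine eq_zero_of_forall_lift_map_eq_zero g m _ fun n => ?_
  -- The map obtained depends on `l`, while one map must serve all `l`. The choice `l = 0` only
  -- supplies some `ψ`; the others have the same values on generators, so they give the same lift on
  -- `R_m`.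
  obtain ⟨ψ, hψ, hψg, -⟩ := hF.exists_lift_eq_zero hr hkm hm n 0
  refine ⟨ψ, hψ, hψg, fun l => ?_⟩
  obtain ⟨ψ', hψ', hψg', h⟩ := hF.exists_lift_eq_zero hr hkm hm n l
  rw [← h]
  exact lift_map_inclusionHom_congr g m _ ψ ψ' hψ hψ' (fun i _ => by rw [hψg, hψg']) _

theorem IsFreeMetabelianProP.normalFormMap_injective {d : ℕ} {g : Fin d → F}
    (hF : IsFreeMetabelianProP p g) : Function.Injective (normalFormMap p g) := by
  rw [injective_iff_map_eq_zero]
  intro r hr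
  -- Descending induction on `j`, with `n` bounding `d - j`; the case `n = 0` is vacuous because `j
  -- < d`.
  have key : ∀ (n : ℕ) (ij : {ij : Fin d × Fin d // ij.1 < ij.2}), d ≤ ij.1.2 + n → r ij = 0 := by
    intro n
    induction n with
    | zero => exact fun ij h => absurd h (by have := ij.1.2.isLt; omega)
    | succ n ih =>
      rintro ⟨⟨k, m⟩, hkm⟩ h
      exact hF.eq_zero_of_forall_lt hr hkm fun ij hij => ih ij (by
        have h1 : (m : ℕ) < ij.1.2 := hij
        have h2 : d ≤ (m : ℕ) + (n + 1) := h
        omega)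
  exact funext fun ij => key d ij (by omega)

end Uniqueness

end

/-- Each element of `A = F'` is uniquely of the form `∑_{i<j} u_ij r_ij` with
`r_ij ∈ R_j = ℤ_p[[X_j]]`. -/
theorem mainTheorem4 (p : ℕ) [Fact p.Prime] (d : ℕ) (hd : 2 ≤ d)
    (F : Type u) [Group F] [TopologicalSpace F] [IsTopologicalGroup F] [CompactSpace F]
    [TotallyDisconnectedSpace F] [IsProP p F] [IsMetabelian F]
    (g : Fin d → F) (hF : IsFreeMetabelianProP p g) (a : Additive (closedDerived F)) :
    ∃! r : (ij : {ij : Fin d × Fin d // ij.1 < ij.2}) →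
        CompletedGroupAlgebra ℤ_[p] (closedSpan g ij.1.2),
      a = ∑ ij : {ij : Fin d × Fin d // ij.1 < ij.2},
        CompletedGroupAlgebra.map ℤ_[p] (inclusionHom (closedSpan g ij.1.2)) (r ij) •
          basicCommutator g ij.1.1 ij.1.2 := by
  obtain ⟨r, hr⟩ := normalFormMap_surjective p g hF.eq_top_of_isClosed a
  exact ⟨r, hr.symm, fun s hs => hF.normalFormMap_injective (hs.symm.trans hr.symm)⟩
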